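/- Let $d\in\{2,3\}$, let $\Omega\subset\mathbb{R}^d$ be a bounded domain with smooth boundary $\Gamma$ and let $\Omega_0\subseteq\Omega$ be open. Let $g_1,g_2\in L^\infty(\Gamma)$ be real valued. Let $P$ be one of the real Hilbert spaces $L^2(\Omega_0)$, $H^1(\Omega_0)$, with its usual inner product $(\cdot,\cdot)_P$. An element $p\in P$ is called an exact source for $(g_1,g_2)$ if there is a real $u\in H^1(\Omega)$ with trace $u=g_1$ on $\Gamma$ and $$\int_\Omega(\nabla u\cdot\nabla\psi+u\psi)\,dx=\int_{\Omega_0}p\,\psi\,dx+\int_\Gamma g_2\,\psi\,ds\qquad\forall\,\psi\in H^1(\Omega),$$ that is, $-\Delta u+u=p\chi_{\Omega_0}$ in $\Omega$, $u=g_1$ and $\partial u/\partial\mathbf n=g_2$ on $\Gamma$, in the weak sense. The data are exact: assume that at least one exact source in $P$ exists. For $p\in P$ let $u(p)\in H^1(\Omega;\mathbb{C})$ be the weak solution of $-\Delta u+u=p\chi_{\Omega_0}$ in $\Omega$, $\partial u/\partial\mathbf n+iu=g_2+ig_1$ on $\Gamma$, and let $w(p)\in H^1(\Omega;\mathbb{C})$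 be the weak solution of $-\Delta w+w=\operatorname{Im}u(p)$ in $\Omega$, $\partial w/\partial\mathbf n+iw=0$ on $\Gamma$. The functional $V(p)=\frac12\|\operatorname{Im}u(p)\|_{L^2(\Omega)}^2$ on $P$ has the derivative $V'(p)q=\int_{\Omega_0}\operatorname{Im}w(p)\,q\,dx$. Let $\eta\ge 1$ be a constant, let $p_0,\dot p_0\in P$, and let $p\in C^1([0,\infty);P)$, twice differentiable on $(0,\infty)$, be the solution of the second order asymptotical regularization (SOAR) system $\ddot p+\eta\dot p+\nabla V(p)=0$, where $\nabla V$ is the gradient of $V$ in $P$, i.e. $$(\ddot p(t)+\eta\,\dot p(t),q)_P+\int_{\Omega_0}\operatorname{Im}w(p(t))\,q\,dx=0\qquad\forall\,q\in P,\ t>0,\qquad p(0)=p_0,\quad\dot p(0)=\dot p_0 .$$ (For $P=L^2(\Omega_0)$ this says $\ddot p+\eta\dot p+\operatorname{Im}w(p)=0$ a.e. in $\Omega_0$.) Then $p(t)$ converges weakly in $P$, as $t\to\infty$, to an exact source in $P$. -/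

import Mathlib

open MeasureTheory Filter Topology
open scoped ENNReal ContDiff RealInnerProductSpace

noncomputable section

namespace InverseSource

variable {d : ℕ}

/-- A bounded domain of `ℝ^d` with smooth boundary: a bounded, connected (non-empty) open set that
near each of its boundary points is the sublevel set `{ρ < 0}` of a smooth function `ρ` with
non-vanishing differential at that point. -/
structure IsSmoothBoundedDomain (Ω : Set (EuclideanSpace ℝ (Fin d))) : Prop where
  isOpen : IsOpen Ω
  isConnected : IsConnected Ω
  isBounded : Bornology.IsBounded Ω
  smooth_boundary : ∀ x ∈ frontier Ω, ∃ ρ : EuclideanSpace ℝ (Fin d) → ℝ,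
    ContDiff ℝ ∞ ρ ∧ fderiv ℝ ρ x ≠ 0 ∧ ∀ᶠ y in 𝓝 x, (y ∈ Ω ↔ ρ y < 0)

/-- The surface measure of the boundary `Γ = ∂Ω`: the `(d-1)`-dimensional Hausdorff measure,
normalized so that it agrees with Lebesgue measure on flat pieces, restricted to `∂Ω`. -/
def surface (Ω : Set (EuclideanSpace ℝ (Fin d))) : Measure (EuclideanSpace ℝ (Fin d)) :=
  (Measure.euclideanHausdorffMeasure (d - 1)).restrict (frontier Ω)

/-- `L²(G)`. -/
abbrev L2 (𝕜 : Type) [RCLike 𝕜] (G : Set (EuclideanSpace ℝ (Fin d))) : Type :=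
  Lp 𝕜 2 (volume.restrict G)

/-- `L²(G)^d`, for vector fields. -/
abbrev L2Vec (𝕜 : Type) [RCLike 𝕜] (G : Set (EuclideanSpace ℝ (Fin d))) : Type :=
  Lp (EuclideanSpace 𝕜 (Fin d)) 2 (volume.restrict G)

/-- `L²(∂Ω)`. -/
abbrev L2Bdry (𝕜 : Type) [RCLike 𝕜] (Ω : Set (EuclideanSpace ℝ (Fin d))) : Type :=
  Lp 𝕜 2 (surface Ω)

/-- The `i`-th partial derivative of a function of `d` real variables. -/
def pderiv {𝕜 : Type} [RCLike 𝕜] (i : Fin d) (φ : EuclideanSpace ℝ (Fin d) → 𝕜)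
    (x : EuclideanSpace ℝ (Fin d)) : 𝕜 :=
  fderiv ℝ φ x (EuclideanSpace.single i 1)

/-- The classical gradient `(∂₁φ, …, ∂_dφ)`. -/
def grad {𝕜 : Type} [RCLike 𝕜] (φ : EuclideanSpace ℝ (Fin d) → 𝕜)
    (x : EuclideanSpace ℝ (Fin d)) : EuclideanSpace 𝕜 (Fin d) :=
  WithLp.toLp 2 fun i => pderiv i φ x

/-- Real-valued test functions on `G`: smooth with compact support inside `G`. -/
structure IsTestFunction (G : Set (EuclideanSpace ℝ (Fin d)))
    (φ : EuclideanSpace ℝ (Fin d) → ℝ) : Prop where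
  contDiff : ContDiff ℝ ∞ φ
  hasCompactSupport : HasCompactSupport φ
  tsupport_subset : tsupport φ ⊆ G

/-- `g` is the weak gradient of `u` on `G`. -/
def IsWeakGrad {𝕜 : Type} [RCLike 𝕜] {G : Set (EuclideanSpace ℝ (Fin d))}
    (u : L2 𝕜 G) (g : L2Vec 𝕜 G) : Prop :=
  ∀ φ, IsTestFunction G φ → ∀ i : Fin d,
    ∫ x in G, ((pderiv i φ x : ℝ) : 𝕜) * u x = - ∫ x in G, (φ x : 𝕜) * g x i

/-- A test function times an `L²` function is integrable. -/
theorem IsTestFunction.integrable_mul {𝕜 : Type} [RCLike 𝕜]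
    {G : Set (EuclideanSpace ℝ (Fin d))} {φ : EuclideanSpace ℝ (Fin d) → ℝ}
    (h : IsTestFunction G φ) {v : EuclideanSpace ℝ (Fin d) → 𝕜}
    (hv : MemLp v 2 (volume.restrict G)) :
    Integrable (fun x => (φ x : 𝕜) * v x) (volume.restrict G) := by
  have h1 : MemLp (fun x => (φ x : 𝕜)) 2 (volume.restrict G) :=
    ((h.contDiff.continuous.memLp_of_hasCompactSupport (p := 2) (μ := volume)
      h.hasCompactSupport).ofReal (K := 𝕜)).restrict G
  exact h1.integrable_mul hv

/-- A partial derivative of a test function times an `L²` function is integrable. -/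
theorem IsTestFunction.integrable_pderiv_mul {𝕜 : Type} [RCLike 𝕜]
    {G : Set (EuclideanSpace ℝ (Fin d))} {φ : EuclideanSpace ℝ (Fin d) → ℝ}
    (h : IsTestFunction G φ) (i : Fin d) {v : EuclideanSpace ℝ (Fin d) → 𝕜}
    (hv : MemLp v 2 (volume.restrict G)) :
    Integrable (fun x => ((pderiv i φ x : ℝ) : 𝕜) * v x) (volume.restrict G) := by
  have hc : Continuous (pderiv i φ) :=
    (h.contDiff.continuous_fderiv (by simp)).clm_apply continuous_const
  have hs : HasCompactSupport (pderiv i φ) :=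
    h.hasCompactSupport.fderiv_apply (𝕜 := ℝ) (EuclideanSpace.single i 1)
  have h1 : MemLp (fun x => ((pderiv i φ x : ℝ) : 𝕜)) 2 (volume.restrict G) :=
    ((hc.memLp_of_hasCompactSupport (p := 2) (μ := volume) hs).ofReal (K := 𝕜)).restrict G
  exact h1.integrable_mul hv

/-- The components of an `L²` vector field are `L²` functions. -/
theorem L2Vec.memLp_apply {𝕜 : Type} [RCLike 𝕜] {G : Set (EuclideanSpace ℝ (Fin d))}
    (g : L2Vec 𝕜 G) (i : Fin d) : MemLp (fun x => g x i) 2 (volume.restrict G) :=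
  (EuclideanSpace.proj (𝕜 := 𝕜) i : EuclideanSpace 𝕜 (Fin d) →L[𝕜] 𝕜).comp_memLp' (Lp.memLp g)

/-- The Sobolev space `H¹(G)`: the pairs `(u, ∇u)` of an `L²` function and its weak gradient in
`L²`, with the inner product `(u, v) + (∇u, ∇v)` inherited from `L²(G) × L²(G)^d`. -/
def H1 (𝕜 : Type) [RCLike 𝕜] (G : Set (EuclideanSpace ℝ (Fin d))) :
    Submodule 𝕜 (WithLp 2 (L2 𝕜 G × L2Vec 𝕜 G)) where
  carrier := {u | IsWeakGrad u.fst u.snd}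
  zero_mem' := by
    intro φ hφ i
    have h1 : ∫ x in G, ((pderiv i φ x : ℝ) : 𝕜) * (0 : L2 𝕜 G) x = 0 := by
      refine (integral_congr_ae ?_).trans (integral_zero _ _)
      filter_upwards [Lp.coeFn_zero 𝕜 2 (volume.restrict G)] with x hx
      simp only [hx, Pi.zero_apply, mul_zero]
    have h2 : ∫ x in G, (φ x : 𝕜) * (0 : L2Vec 𝕜 G) x i = 0 := by
      refine (integral_congr_ae ?_).trans (integral_zero _ _)
      filter_upwards [Lp.coeFn_zero (EuclideanSpace 𝕜 (Fin d)) 2 (volume.restrict G)] with x hx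
      simp only [hx, Pi.zero_apply, PiLp.zero_apply, mul_zero]
    exact h1.trans (by rw [← neg_zero, ← h2]; rfl)
  add_mem' := by
    intro u v hu hv φ hφ i
    have h1 : ∫ x in G, ((pderiv i φ x : ℝ) : 𝕜) * (u.fst + v.fst) x =
        (∫ x in G, ((pderiv i φ x : ℝ) : 𝕜) * u.fst x) + ∫ x in G, ((pderiv i φ x : ℝ) : 𝕜) * v.fst x := by
      rw [← integral_add (hφ.integrable_pderiv_mul i (Lp.memLp _))
        (hφ.integrable_pderiv_mul i (Lp.memLp _))]
      refine integral_congr_ae ?_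
      filter_upwards [Lp.coeFn_add u.fst v.fst] with x hx
      simp only [hx, Pi.add_apply, mul_add]
    have h2 : ∫ x in G, (φ x : 𝕜) * (u.snd + v.snd) x i =
        (∫ x in G, (φ x : 𝕜) * u.snd x i) + ∫ x in G, (φ x : 𝕜) * v.snd x i := by
      rw [← integral_add (hφ.integrable_mul (u.snd.memLp_apply i))
        (hφ.integrable_mul (v.snd.memLp_apply i))]
      refine integral_congr_ae ?_
      filter_upwards [Lp.coeFn_add u.snd v.snd] with x hx
      simp only [hx, Pi.add_apply, PiLp.add_apply, mul_add]
    change ∫ x in G, ((pderiv i φ x : ℝ) : 𝕜) * (u.fst + v.fst) x =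
      - ∫ x in G, (φ x : 𝕜) * (u.snd + v.snd) x i
    rw [h1, h2, hu φ hφ i, hv φ hφ i, neg_add]
  smul_mem' := by
    intro c u hu φ hφ i
    have h1 : ∫ x in G, ((pderiv i φ x : ℝ) : 𝕜) * (c • u.fst) x =
        c * ∫ x in G, ((pderiv i φ x : ℝ) : 𝕜) * u.fst x := by
      rw [← integral_const_mul]
      refine integral_congr_ae ?_
      filter_upwards [Lp.coeFn_smul c u.fst] with x hx
      simp only [hx, Pi.smul_apply, smul_eq_mul]
      ring
    have h2 : ∫ x in G, (φ x : 𝕜) * (c • u.snd) x i =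
        c * ∫ x in G, (φ x : 𝕜) * u.snd x i := by
      rw [← integral_const_mul]
      refine integral_congr_ae ?_
      filter_upwards [Lp.coeFn_smul c u.snd] with x hx
      simp only [hx, Pi.smul_apply, PiLp.smul_apply, smul_eq_mul]
      ring
    change ∫ x in G, ((pderiv i φ x : ℝ) : 𝕜) * (c • u.fst) x =
      - ∫ x in G, (φ x : 𝕜) * (c • u.snd) x i
    rw [h1, h2, hu φ hφ i, mul_neg]

/-- The underlying `L²` function of an `H¹` function. -/
def h1val {𝕜 : Type} [RCLike 𝕜] {G : Set (EuclideanSpace ℝ (Fin d))} (u : H1 𝕜 G) : L2 𝕜 G :=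
  (u : WithLp 2 (L2 𝕜 G × L2Vec 𝕜 G)).fst

/-- The weak gradient of an `H¹` function. -/
def h1grad {𝕜 : Type} [RCLike 𝕜] {G : Set (EuclideanSpace ℝ (Fin d))} (u : H1 𝕜 G) :
    L2Vec 𝕜 G :=
  (u : WithLp 2 (L2 𝕜 G × L2Vec 𝕜 G)).snd

/-- `τ ∈ L²(∂Ω)` is the trace of `u ∈ H¹(Ω)`: some sequence of smooth functions on `ℝ^d` converges
to `u` in `H¹(Ω)` while its restrictions to the boundary converge to `τ` in `L²(∂Ω)`. -/
def IsTrace {𝕜 : Type} [RCLike 𝕜] {Ω : Set (EuclideanSpace ℝ (Fin d))}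
    (u : H1 𝕜 Ω) (τ : L2Bdry 𝕜 Ω) : Prop :=
  ∃ φ : ℕ → EuclideanSpace ℝ (Fin d) → 𝕜, (∀ n, ContDiff ℝ ∞ (φ n)) ∧
    Tendsto (fun n => eLpNorm (fun x => h1val u x - φ n x) 2 (volume.restrict Ω)) atTop (𝓝 0) ∧
    Tendsto (fun n => eLpNorm (fun x => h1grad u x - grad (φ n) x) 2 (volume.restrict Ω))
      atTop (𝓝 0) ∧
    Tendsto (fun n => eLpNorm (fun x => τ x - φ n x) 2 (surface Ω)) atTop (𝓝 0)

/-- The sesquilinear form of the Robin problem,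
`a(u, ψ) = ∫_Ω (∇u · ∇ψ̄ + u ψ̄) dx + i ∫_Γ u ψ̄ ds`, where `τ`, `θ` are the traces of `u`, `ψ`. -/
def robinForm {Ω : Set (EuclideanSpace ℝ (Fin d))} (u : H1 ℂ Ω) (τ : L2Bdry ℂ Ω)
    (ψ : H1 ℂ Ω) (θ : L2Bdry ℂ Ω) : ℂ :=
  (∫ x in Ω, ((∑ i, h1grad u x i * star (h1grad ψ x i)) + h1val u x * star (h1val ψ x)))
    + Complex.I * ∫ x, τ x * star (θ x) ∂(surface Ω)

/-- `u` is the weak solution in `H¹(Ω; ℂ)` of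
`-Δu + u = p χ_{Ω₀}` in `Ω`, `∂u/∂n + i u = g₂ + i g₁` on `Γ`. -/
def IsState (Ω Ω₀ : Set (EuclideanSpace ℝ (Fin d))) (g₁ g₂ : EuclideanSpace ℝ (Fin d) → ℝ)
    (p : L2 ℝ Ω₀) (u : H1 ℂ Ω) : Prop :=
  ∃ τ : L2Bdry ℂ Ω, IsTrace u τ ∧
    ∀ (ψ : H1 ℂ Ω) (θ : L2Bdry ℂ Ω), IsTrace ψ θ →
      robinForm u τ ψ θ = (∫ x in Ω₀, (p x : ℂ) * star (h1val ψ x))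
        + (∫ x, (g₂ x : ℂ) * star (θ x) ∂(surface Ω))
        + Complex.I * ∫ x, (g₁ x : ℂ) * star (θ x) ∂(surface Ω)

/-- `w` is the weak solution in `H¹(Ω; ℂ)` of the adjoint problem
`-Δw + w = Im u` in `Ω`, `∂w/∂n + i w = 0` on `Γ`. -/
def IsAdjointState {Ω : Set (EuclideanSpace ℝ (Fin d))} (u w : H1 ℂ Ω) : Prop :=
  ∃ τ : L2Bdry ℂ Ω, IsTrace w τ ∧
    ∀ (ψ : H1 ℂ Ω) (θ : L2Bdry ℂ Ω), IsTrace ψ θ →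
      robinForm w τ ψ θ = ∫ x in Ω, ((h1val u x).im : ℂ) * star (h1val ψ x)

/-- `p` is an exact source for the data `(g₁, g₂)`: there is `u ∈ H¹(Ω)` (real valued) which solves
`-Δu + u = p χ_{Ω₀}` in `Ω`, `∂u/∂n = g₂` on `Γ` weakly, and has trace `g₁` on `Γ`. -/
def IsExactSource (Ω Ω₀ : Set (EuclideanSpace ℝ (Fin d)))
    (g₁ g₂ : EuclideanSpace ℝ (Fin d) → ℝ) (p : L2 ℝ Ω₀) : Prop :=
  ∃ (u : H1 ℝ Ω) (τ : L2Bdry ℝ Ω), IsTrace u τ ∧ τ =ᵐ[surface Ω] g₁ ∧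
    ∀ (ψ : H1 ℝ Ω) (θ : L2Bdry ℝ Ω), IsTrace ψ θ →
      (∫ x in Ω, ((∑ i, h1grad u x i * h1grad ψ x i) + h1val u x * h1val ψ x))
        = (∫ x in Ω₀, p x * h1val ψ x) + ∫ x, g₂ x * θ x ∂(surface Ω)

/-- `p : [0, ∞) → P` solves the second order (SOAR) system with constant damping `η`, data
`(g₁, g₂)` and initial values `p(0) = p₀`, `p'(0) = v₀`. Here the Hilbert space `P` is the source
space, whose elements are functions on `Ω₀` through `ι : P → L²(Ω₀)`; `u`, `w` are the state and
the adjoint state at time `t`. The evolution equation `p'' + η p' + ∇V(p) = 0` is tested against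
all `q ∈ P`; the functional `V(p) = ½ ‖Im u(p)‖²_{L²(Ω)}` has the derivative
`V'(p) q = ∫_{Ω₀} (Im w) q dx`. For `P = L²(Ω₀)` the equation says `p'' + η p' + Im w = 0` a.e. in
`Ω₀`. -/
def IsSOARSolution {P : Type} [NormedAddCommGroup P] [InnerProductSpace ℝ P]
    (Ω Ω₀ : Set (EuclideanSpace ℝ (Fin d))) (ι : P → L2 ℝ Ω₀)
    (g₁ g₂ : EuclideanSpace ℝ (Fin d) → ℝ) (η : ℝ) (p₀ v₀ : P) (p : ℝ → P) : Prop :=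
  ∃ v a : ℝ → P,
    (∀ t, 0 ≤ t → HasDerivWithinAt p (v t) (Set.Ici 0) t) ∧
    ContinuousOn v (Set.Ici 0) ∧
    (∀ t, 0 < t → HasDerivAt v (a t) t) ∧
    p 0 = p₀ ∧ v 0 = v₀ ∧
    ∀ t, 0 < t → ∃ u w : H1 ℂ Ω, IsState Ω Ω₀ g₁ g₂ (ι (p t)) u ∧ IsAdjointState u w ∧
      ∀ q : P, ⟪a t + η • v t, q⟫ + ∫ x in Ω₀, (h1val w x).im * ι q x = 0

/-- `p(t)` converges weakly in `P` to `l` as `t → ∞`. -/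
def WeaklyTendsto {P : Type} [NormedAddCommGroup P] [InnerProductSpace ℝ P]
    (p : ℝ → P) (l : P) : Prop :=
  Tendsto (fun t => toWeakSpace ℝ P (p t)) atTop (𝓝 (toWeakSpace ℝ P l))

end InverseSource

end

noncomputable section

namespace InverseSource

variable {d : ℕ}

/-! ### Energy dissipation for the damped system. -/

section Dissipation

/-! Subtracting a fixed exact source and its real state from `(p, u(p))` removes the data `g₁`,
`g₂`. The difference `δ₁ + iδ₂` solves a homogeneous Robin problem depending linearly on `p - ps`,
and `Im u(p)` is `δ₂`. So `V` is a nonnegative quadratic functional of `p - ps`, and an exact source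
is a point whose difference has `δ₂ = 0`. Symmetry of the forms (`CoupledState.reciprocity`)
identifies the gradient with the imaginary part of the adjoint state.

For a damped flow of such a functional, the energy `|v|²/2 + V` and a modified Lyapunov function
show that `V → 0` along the trajectory and that the distance to every exact source converges
(`tendsto_of_damped_system`). The trajectory is therefore bounded, and states are bounded by sources
(`CoupledState.norm_le`), so weak limits exist along ultrafilters. The limit of `δ₂` has zero `L²`
value, hence vanishes as an `H¹` function, and the real equation kills its boundary part as well;
the limit of `p` is thus an exact source. Convergence of the distances makes all these limits equal,
which is Opial's argument (`exists_weak_limit_of_soar`).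

No trace theorem enters: functions are carried together with one of their traces, as points of the
Hilbert space `TraceSpace`. The source space enters only through a continuous map `ι` into `L²(Ω₀)`,
so `L²` and `H¹` sources are treated at once. -/

theorem antitoneOn_Ici_of_hasDerivAt_nonpos {f f' : ℝ → ℝ} {T : ℝ}
    (hf : ∀ t, T ≤ t → HasDerivAt f (f' t) t) (hf' : ∀ t, T ≤ t → f' t ≤ 0) :
    AntitoneOn f (Set.Ici T) := by
  refine antitoneOn_of_deriv_nonpos (convex_Ici T)
    (fun t ht => (hf t ht).continuousAt.continuousWithinAt) (fun t ht => ?_) (fun t ht => ?_)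
  · rw [interior_Ici] at ht
    exact (hf t (le_of_lt ht)).differentiableAt.differentiableWithinAt
  · rw [interior_Ici] at ht
    rw [(hf t (le_of_lt ht)).deriv]
    exact hf' t (le_of_lt ht)

theorem AntitoneOn.exists_tendsto_atTop_of_le {f : ℝ → ℝ} {T m : ℝ}
    (hf : AntitoneOn f (Set.Ici T)) (hm : ∀ t, T ≤ t → m ≤ f t) :
    ∃ L, m ≤ L ∧ (∀ t, T ≤ t → L ≤ f t) ∧ Tendsto f atTop (𝓝 L) := by
  have ha : Antitone fun t => f (max t T) := fun s t hst =>
    hf (le_max_right s T) (le_max_right t T) (max_le_max_right T hst)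
  have hb : BddBelow (Set.range fun t => f (max t T)) :=
    ⟨m, by rintro _ ⟨t, rfl⟩; exact hm _ (le_max_right t T)⟩
  refine ⟨_, le_ciInf fun t => hm _ (le_max_right t T), fun t ht => ?_,
    (tendsto_atTop_ciInf ha hb).congr' ?_⟩
  · simpa [max_eq_left ht] using ciInf_le hb t
  · filter_upwards [eventually_ge_atTop T] with t ht
    simp [max_eq_left ht]

/-- A one-sided comparison principle for `h' + η h ≤ c`. -/
theorem eventually_le_of_deriv_add_mul_le {η c : ℝ} (hη : 0 < η) {h h' : ℝ → ℝ} {T : ℝ}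
    (hd : ∀ t, T ≤ t → HasDerivAt h (h' t) t) (hc : ∀ t, T ≤ t → h' t + η * h t ≤ c)
    {ε : ℝ} (hε : 0 < ε) : ∀ᶠ t in atTop, h t ≤ c / η + ε := by
  -- Integrating factor: `h - c/η` decays at least like `exp (-η t)`.
  have hanti : AntitoneOn (fun t => Real.exp (η * t) * (h t - c / η)) (Set.Ici T) := by
    refine antitoneOn_Ici_of_hasDerivAt_nonpos
      (f' := fun t => Real.exp (η * t) * η * (h t - c / η) + Real.exp (η * t) * h' t)
      (fun t ht => ?_) (fun t ht => ?_)
    · have h1 : HasDerivAt (fun t : ℝ => Real.exp (η * t)) (Real.exp (η * t) * η) t := by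
        simpa using ((hasDerivAt_id t).const_mul η).exp
      exact h1.mul ((hd t ht).sub_const _)
    · have h2 : Real.exp (η * t) * η * (h t - c / η) + Real.exp (η * t) * h' t
          = Real.exp (η * t) * (h' t + η * h t - c) := by
        field_simp
        ring
      rw [h2]
      exact mul_nonpos_of_nonneg_of_nonpos (Real.exp_pos _).le (by linarith [hc t ht])
  set C := Real.exp (η * T) * (h T - c / η) with hC
  have hlim : Tendsto (fun t : ℝ => Real.exp (-(η * t)) * C) atTop (𝓝 0) := by
    have h3 : Tendsto (fun t : ℝ => Real.exp (-(η * t))) atTop (𝓝 0) :=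
      Real.tendsto_exp_neg_atTop_nhds_zero.comp (tendsto_id.const_mul_atTop hη)
    simpa using h3.mul_const C
  filter_upwards [eventually_ge_atTop T, hlim.eventually (eventually_le_nhds hε)] with t ht hle
  have h4 : Real.exp (η * t) * (h t - c / η) ≤ C :=
    hanti Set.self_mem_Ici (Set.mem_Ici.2 ht) ht
  have h5 := mul_le_mul_of_nonneg_left h4 (Real.exp_pos (-(η * t))).le
  rw [← mul_assoc, ← Real.exp_add, neg_add_cancel, Real.exp_zero, one_mul] at h5
  linarith

/-- If `h' + η h` converges at infinity, then so does `h`. -/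
theorem tendsto_of_tendsto_deriv_add_mul {η L : ℝ} (hη : 0 < η) {h h' : ℝ → ℝ} {T : ℝ}
    (hd : ∀ t, T ≤ t → HasDerivAt h (h' t) t)
    (hL : Tendsto (fun t => h' t + η * h t) atTop (𝓝 L)) :
    Tendsto h atTop (𝓝 (L / η)) := by
  refine tendsto_order.2 ⟨fun l hl => ?_, fun r hr => ?_⟩
  -- One `ε` is lost in approximating the limit and one in the comparison principle; the third keeps
  -- the inequality strict.
  · set ε := (L / η - l) / 3
    have hε : 0 < ε := by simp only [ε]; linarith
    obtain ⟨S, hS⟩ := eventually_atTop.1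
      (hL.eventually (lt_mem_nhds (show L - η * ε < L by nlinarith)))
    have key := eventually_le_of_deriv_add_mul_le (c := -(L - η * ε)) hη
      (h := fun t => -h t) (h' := fun t => -h' t) (T := max S T)
      (fun t ht => (hd t (le_trans (le_max_right _ _) ht)).neg)
      (fun t ht => by linarith [hS t (le_trans (le_max_left _ _) ht)]) hε
    filter_upwards [key] with t ht
    have : -(L - η * ε) / η = -(L / η) + ε := by field_simp; ring
    rw [this] at ht
    have : 3 * ε = L / η - l := by simp only [ε]; ring
    linarith
  · set ε := (r - L / η) / 3
    have hε : 0 < ε := by simp only [ε]; linarith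
    obtain ⟨S, hS⟩ := eventually_atTop.1
      (hL.eventually (gt_mem_nhds (show L < L + η * ε by nlinarith)))
    have key := eventually_le_of_deriv_add_mul_le (c := L + η * ε) hη
      (h := h) (h' := h') (T := max S T)
      (fun t ht => hd t (le_trans (le_max_right _ _) ht))
      (fun t ht => (hS t (le_trans (le_max_left _ _) ht)).le) hε
    filter_upwards [key] with t ht
    have : (L + η * ε) / η = L / η + ε := by field_simp
    rw [this] at ht
    have : 3 * ε = r - L / η := by simp only [ε]; ring
    linarith

variable {P : Type*} [NormedAddCommGroup P] [InnerProductSpace ℝ P]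

/-- Dissipation for the damped system `x'' + η x' + g = 0`, where `g` is the gradient at `x` of a
nonnegative quadratic functional vanishing at the origin, with the values `V t` along `x`: the
functional tends to zero along the trajectory, and the distance to the origin converges. -/
theorem tendsto_of_damped_system {η : ℝ} (hη : 0 < η) {x v a g : ℝ → P} {V : ℝ → ℝ}
    (hx : ∀ t, 0 < t → HasDerivAt x (v t) t) (hv : ∀ t, 0 < t → HasDerivAt v (a t) t)
    (heq : ∀ t, 0 < t → a t + η • v t + g t = 0) (hV0 : ∀ t, 0 ≤ V t)
    (hV : ∀ t, 0 < t → HasDerivAt V ⟪g t, v t⟫ t)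
    (hg : ∀ t, 0 < t → ⟪g t, x t⟫ = 2 * V t) :
    Tendsto V atTop (𝓝 0) ∧ ∃ L, Tendsto (fun t => ‖x t‖ ^ 2) atTop (𝓝 L) := by
  have ha : ∀ t, 0 < t → a t = -(η • v t) - g t := fun t ht => by
    rw [eq_sub_iff_add_eq, eq_neg_iff_add_eq_zero, ← heq t ht]; abel
  have hpos : ∀ t : ℝ, 1 ≤ t → 0 < t := fun t ht => by linarith
  set E : ℝ → ℝ := fun t => ⟪v t, v t⟫ / 2 + V t with hE
  set F : ℝ → ℝ := fun t => ⟪v t, x t⟫ + η * (⟪x t, x t⟫ / 2) with hF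
  have hvv : ∀ t, 0 ≤ ⟪v t, v t⟫ := fun t => real_inner_self_nonneg
  have hE0 : ∀ t, 0 ≤ E t := fun t => by have := hV0 t; have := hvv t; simp only [hE]; linarith
  have hE' : ∀ t, 0 < t → HasDerivAt E (-(η * ⟪v t, v t⟫)) t := fun t ht => by
    refine ((((hv t ht).inner ℝ (hv t ht)).div_const 2).add (hV t ht)).congr_deriv ?_
    rw [ha t ht]
    simp only [inner_sub_left, inner_sub_right, inner_neg_left, inner_neg_right,
      real_inner_smul_left, real_inner_smul_right, real_inner_comm (g t) (v t)]
    ring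
  have hF' : ∀ t, 0 < t → HasDerivAt F (⟪v t, v t⟫ - 2 * V t) t := fun t ht => by
    refine (((hv t ht).inner ℝ (hx t ht)).add
      ((((hx t ht).inner ℝ (hx t ht)).div_const 2).const_mul η)).congr_deriv ?_
    rw [ha t ht, ← hg t ht]
    simp only [inner_sub_left, inner_neg_left, real_inner_smul_left,
      real_inner_comm (v t) (x t)]
    ring
  -- The weight `2 / η` turns the kinetic term `|v|²` of `F'` into `-|v|²`, which together with
  -- `-2V` is exactly `-2E`.
  have hG' : ∀ t, 0 < t → HasDerivAt (fun t => F t + 2 / η * E t) (-(2 * E t)) t := fun t ht => by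
    refine ((hF' t ht).add ((hE' t ht).const_mul (2 / η))).congr_deriv ?_
    simp only [hE]
    field_simp
    ring
  -- Completing the square: `2η (F + (2/η) E) = |v + ηx|² + |v|² + 4V`.
  have hG0 : ∀ t, 0 ≤ F t + 2 / η * E t := fun t => by
    have h1 : 0 ≤ ⟪v t + η • x t, v t + η • x t⟫ := real_inner_self_nonneg
    simp only [inner_add_left, inner_add_right, real_inner_smul_left, real_inner_smul_right,
      real_inner_comm (v t) (x t)] at h1
    have h2 : F t + 2 / η * E t = (⟪v t, v t⟫ + η * ⟪v t, x t⟫ +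
        (η * ⟪v t, x t⟫ + η * (η * ⟪x t, x t⟫)) + (⟪v t, v t⟫ + 4 * V t)) / (2 * η) := by
      simp only [hE, hF]
      field_simp
      ring
    rw [h2]
    have := hvv t
    have := hV0 t
    have h3 := h1
    rw [real_inner_comm] at h3
    positivity
  obtain ⟨E₀, hE₀, hle, hElim⟩ := AntitoneOn.exists_tendsto_atTop_of_le
    (antitoneOn_Ici_of_hasDerivAt_nonpos (fun t ht => hE' t (hpos t ht))
      (fun t _ => neg_nonpos.2 (mul_nonneg hη.le (hvv t)))) (fun t _ => hE0 t)
  obtain ⟨G₀, -, -, hGlim⟩ := AntitoneOn.exists_tendsto_atTop_of_le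
    (antitoneOn_Ici_of_hasDerivAt_nonpos (fun t ht => hG' t (hpos t ht))
      (fun t _ => neg_nonpos.2 (mul_nonneg zero_le_two (hE0 t)))) (fun t _ => hG0 t)
  -- If the energy stayed above a positive level, `F + (2/η) E` would decrease at least linearly and
  -- become negative.
  have hzero : E₀ = 0 := by
    have hanti : AntitoneOn (fun t => (F t + 2 / η * E t) + 2 * E₀ * t) (Set.Ici 1) :=
      antitoneOn_Ici_of_hasDerivAt_nonpos (f' := fun t => -(2 * E t) + 2 * E₀)
        (fun t ht => ((hG' t (hpos t ht)).add ((hasDerivAt_id t).const_mul (2 * E₀))).congr_deriv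
          (by simp))
        (fun t ht => by linarith [hle t ht])
    by_contra hne
    have hE₀' : 0 < E₀ := lt_of_le_of_ne hE₀ (Ne.symm hne)
    set C := (F 1 + 2 / η * E 1) + 2 * E₀ * 1
    have hC : ∀ t, 1 ≤ t → 2 * E₀ * t ≤ C := fun t ht => by
      have h1 : (F t + 2 / η * E t) + 2 * E₀ * t ≤ C :=
        hanti Set.self_mem_Ici (Set.mem_Ici.2 ht) ht
      linarith [hG0 t]
    have h2 := hC (max 1 ((C + 1) / (2 * E₀))) (le_max_left _ _)
    have h3 : 2 * E₀ * ((C + 1) / (2 * E₀)) ≤ 2 * E₀ * max 1 ((C + 1) / (2 * E₀)) :=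
      mul_le_mul_of_nonneg_left (le_max_right _ _) (by positivity)
    rw [mul_div_cancel₀ _ (by positivity)] at h3
    linarith
  rw [hzero] at hElim
  refine ⟨squeeze_zero hV0 (fun t => ?_) hElim, ?_⟩
  · simp only [hE]; linarith [hvv t]
  have hFlim : Tendsto F atTop (𝓝 G₀) := by
    have h1 := hGlim.sub (hElim.const_mul (2 / η))
    simpa using h1
  -- With `h = |x|²/2` one has `F = h' + ηh`.
  have hlim := tendsto_of_tendsto_deriv_add_mul (h := fun t => ⟪x t, x t⟫ / 2)
    (h' := fun t => ⟪v t, x t⟫) hη (T := 1)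
    (fun t ht => (((hx t (hpos t ht)).inner ℝ (hx t (hpos t ht))).div_const 2).congr_deriv
      (by rw [real_inner_comm (v t) (x t)]; ring)) hFlim
  refine ⟨2 * (G₀ / η), (hlim.const_mul 2).congr fun t => ?_⟩
  rw [← real_inner_self_eq_norm_sq]
  ring

end Dissipation

/-! ### Abstract coupled system and weak convergence of its damped flow. -/

section Coupled

variable {P Q T X Y H : Type*}
  [NormedAddCommGroup P] [InnerProductSpace ℝ P] [NormedAddCommGroup Q] [InnerProductSpace ℝ Q]
  [NormedAddCommGroup T] [InnerProductSpace ℝ T] [NormedAddCommGroup X] [InnerProductSpace ℝ X]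
  [NormedAddCommGroup Y] [InnerProductSpace ℝ Y] [NormedAddCommGroup H] [InnerProductSpace ℝ H]
  {B : T →L[ℝ] X} {K : T →L[ℝ] Y} {κ : T →L[ℝ] P}

/-- The real form of a Robin problem with complex boundary coefficient: `δ₁`, `δ₂` are the real and
imaginary parts of the solution, `⟪B ·, B ·⟫` is the form of the volume terms, `⟪K ·, K ·⟫` the form
of the boundary terms, and the right-hand side is `ψ ↦ ⟪q, κ ψ⟫`. -/
structure CoupledState (B : T →L[ℝ] X) (K : T →L[ℝ] Y) (κ : T →L[ℝ] P) (q : P) (δ₁ δ₂ : T) :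
    Prop where
  re_eq : ∀ ψ, ⟪B δ₁, B ψ⟫ - ⟪K δ₂, K ψ⟫ = ⟪q, κ ψ⟫
  im_eq : ∀ ψ, ⟪B δ₂, B ψ⟫ + ⟪K δ₁, K ψ⟫ = 0

/-- The norm of `T` is composed of the forms of the volume and the boundary terms. -/
def SplitsNorm (B : T →L[ℝ] X) (K : T →L[ℝ] Y) : Prop :=
  ∀ x, ‖x‖ ^ 2 = ‖B x‖ ^ 2 + ‖K x‖ ^ 2

namespace CoupledState

theorem sub {q q' : P} {δ₁ δ₂ δ₁' δ₂' : T} (h : CoupledState B K κ q δ₁ δ₂)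
    (h' : CoupledState B K κ q' δ₁' δ₂') :
    CoupledState B K κ (q - q') (δ₁ - δ₁') (δ₂ - δ₂') where
  re_eq ψ := by
    simp only [map_sub, inner_sub_left, ← h.re_eq, ← h'.re_eq]
    ring
  im_eq ψ := by
    have h1 := h.im_eq ψ
    have h2 := h'.im_eq ψ
    simp only [map_sub, inner_sub_left]
    linarith

/-- The Neumann data, represented by `g`, and the Dirichlet data, represented by `K y`, both cancel
in the difference. -/
theorem of_sub {q q' : P} {x y z : T} {r r' g : T → ℝ} (hq : ∀ ψ, ⟪q, κ ψ⟫ = r ψ)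
    (hq' : ∀ ψ, ⟪q', κ ψ⟫ = r' ψ) (hre : ∀ ψ, ⟪B x, B ψ⟫ - ⟪K z, K ψ⟫ = r ψ + g ψ)
    (hy : ∀ ψ, ⟪B y, B ψ⟫ = r' ψ + g ψ) (him : ∀ ψ, ⟪B z, B ψ⟫ + ⟪K x, K ψ⟫ = ⟪K y, K ψ⟫) :
    CoupledState B K κ (q - q') (x - y) z where
  re_eq ψ := by
    rw [map_sub, inner_sub_left, inner_sub_left, hy, hq, hq', sub_right_comm, hre]
    ring
  im_eq ψ := by
    rw [map_sub, inner_sub_left, ← add_sub_assoc, him, sub_self]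

/-- Converse to `of_sub` for vanishing imaginary part: testing `im_eq` with `D` gives `K D = 0`, so
adding `D` changes the source without changing the trace. -/
theorem map_add_of_sub {q q' : P} {y D : T} {r r' g : T → ℝ} (h : CoupledState B K κ (q - q') D 0)
    (hq : ∀ ψ, ⟪q, κ ψ⟫ = r ψ) (hq' : ∀ ψ, ⟪q', κ ψ⟫ = r' ψ)
    (hy : ∀ ψ, ⟪B y, B ψ⟫ = r' ψ + g ψ) :
    K (y + D) = K y ∧ ∀ ψ, ⟪B (y + D), B ψ⟫ = r ψ + g ψ := by
  constructor
  · have h1 := h.im_eq D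
    rw [map_zero, inner_zero_left, zero_add, inner_self_eq_zero] at h1
    rw [map_add, h1, add_zero]
  · intro ψ
    have h1 := h.re_eq ψ
    rw [map_zero, inner_zero_left, sub_zero, inner_sub_left, hq, hq'] at h1
    rw [map_add, inner_add_left, hy, h1]
    ring

/-- Both forms are symmetric, so each problem may be tested with the solution of the other; the two
imaginary equations link the remaining cross terms. With `q' = J δ₂` this says that `κ w₂` is the
gradient of `‖J δ₂‖² / 2`. -/
theorem reciprocity {κ' : T →L[ℝ] Q} {q : P} {q' : Q} {δ₁ δ₂ w₁ w₂ : T}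
    (h : CoupledState B K κ q δ₁ δ₂) (h' : CoupledState B K κ' q' w₁ w₂) :
    ⟪q, κ w₂⟫ = ⟪q', κ' δ₂⟫ := by
  rw [← h.re_eq, ← h'.re_eq]
  have h1 := h.im_eq w₁
  have h2 := h'.im_eq δ₁
  rw [real_inner_comm (B w₁) (B δ₂), real_inner_comm (B δ₁) (B w₂), real_inner_comm (K δ₁) (K w₁),
    real_inner_comm (K w₂) (K δ₂)] at *
  linarith

theorem norm_le (hBK : SplitsNorm B K) {q : P} {δ₁ δ₂ : T}
    (h : CoupledState B K κ q δ₁ δ₂) : ‖δ₁‖ + ‖δ₂‖ ≤ 2 * ‖κ‖ * ‖q‖ := by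
  have h1 := h.re_eq δ₁
  have h2 := h.im_eq δ₂
  have h3 := h.re_eq δ₂
  have h4 := h.im_eq δ₁
  rw [real_inner_comm (B δ₁) (B δ₂)] at h4
  rw [real_inner_comm (K δ₁) (K δ₂)] at h1
  simp only [real_inner_self_eq_norm_sq] at h1 h2 h3 h4
  -- Testing the real equation with `δ₁ - δ₂` and the imaginary one with `δ₁ + δ₂` cancels the mixed
  -- terms and gives coercivity in both the volume and the boundary parts.
  have h5 : ‖δ₁‖ ^ 2 + ‖δ₂‖ ^ 2 = ⟪q, κ δ₁⟫ - ⟪q, κ δ₂⟫ := by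
    rw [hBK δ₁, hBK δ₂]; linarith
  have h6 : ∀ δ, |⟪q, κ δ⟫| ≤ ‖κ‖ * ‖q‖ * ‖δ‖ := fun δ =>
    (abs_real_inner_le_norm _ _).trans (by
      have := mul_le_mul_of_nonneg_left (κ.le_opNorm δ) (norm_nonneg q)
      linarith)
  have h7 := (le_abs_self _).trans (h6 δ₁)
  have h8 := (neg_le_abs _).trans (h6 δ₂)
  have h9 : (‖δ₁‖ + ‖δ₂‖) * (‖δ₁‖ + ‖δ₂‖) ≤ (2 * ‖κ‖ * ‖q‖) * (‖δ₁‖ + ‖δ₂‖) := by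
    nlinarith [sq_nonneg (‖δ₁‖ - ‖δ₂‖)]
  by_contra! hlt
  have h0 : 0 ≤ 2 * ‖κ‖ * ‖q‖ := by positivity
  exact absurd h9 (not_le.2 (mul_lt_mul_of_pos_right hlt (h0.trans_lt hlt)))

end CoupledState

/-- Along a bounded trajectory, every ultrafilter has a weak limit in a Hilbert space. -/
theorem exists_weak_limit_of_bounded [CompleteSpace T] {ι : Type*} (U : Ultrafilter ι) {f : ι → T}
    {M : ℝ} (hf : ∀ᶠ t in (U : Filter ι), ‖f t‖ ≤ M) :
    ∃ l : T, ∀ y : T, Tendsto (fun t => ⟪f t, y⟫) U (𝓝 ⟪l, y⟫) := by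
  have hb : ∀ y : T, ∀ᶠ t in (U : Filter ι), |⟪f t, y⟫| ≤ M * ‖y‖ := fun y =>
    hf.mono fun t ht => (abs_real_inner_le_norm _ _).trans
      (mul_le_mul_of_nonneg_right ht (norm_nonneg y))
  -- An ultrafilter converges on a compact interval, simultaneously for every `y`, so no subsequence
  -- has to be extracted. The limits form a bounded functional, which Riesz represents.
  have hex : ∀ y : T, ∃ c, Tendsto (fun t => ⟪f t, y⟫) U (𝓝 c) := fun y => by
    obtain ⟨c, -, hc⟩ := (isCompact_Icc (a := -(M * ‖y‖)) (b := M * ‖y‖)).ultrafilter_le_nhds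
      (U.map fun t => ⟪f t, y⟫) (by
        rw [le_principal_iff]
        exact (hb y).mono fun t ht => abs_le.1 ht)
    exact ⟨c, hc⟩
  choose c hc using hex
  have hadd : ∀ x y, c (x + y) = c x + c y := fun x y =>
    tendsto_nhds_unique (hc (x + y)) (by simpa only [inner_add_right] using (hc x).add (hc y))
  have hsmul : ∀ (r : ℝ) x, c (r • x) = r • c x := fun r x =>
    tendsto_nhds_unique (hc (r • x)) (by
      simpa only [real_inner_smul_right, smul_eq_mul] using (hc x).const_mul r)
  let φ : T →L[ℝ] ℝ := LinearMap.mkContinuous ⟨⟨c, hadd⟩, hsmul⟩ M fun y =>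
    le_of_tendsto (hc y).abs (hb y)
  refine ⟨(InnerProductSpace.toDual ℝ T).symm φ, fun y => ?_⟩
  rw [InnerProductSpace.toDual_symm_apply]
  exact hc y

/-- Bounded operators are weakly continuous. `X` need not be complete, so the functional `u ↦ ⟪A u,
z⟫` is represented in `T` directly instead of through an adjoint of `A`. -/
theorem tendsto_inner_map_of_weak [CompleteSpace T] {ι : Type*} {l : Filter ι} {f : ι → T} {x : T}
    (hf : ∀ y, Tendsto (fun t => ⟪f t, y⟫) l (𝓝 ⟪x, y⟫)) (A : T →L[ℝ] X) (z : X) :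
    Tendsto (fun t => ⟪A (f t), z⟫) l (𝓝 ⟪A x, z⟫) := by
  have h : ∀ u, ⟪A u, z⟫ = ⟪u, (InnerProductSpace.toDual ℝ T).symm ((innerSL ℝ z).comp A)⟫ :=
    fun u => by
      rw [real_inner_comm, real_inner_comm _ u, InnerProductSpace.toDual_symm_apply]
      rfl
  simpa only [h] using hf _

/-- The squared norm of the observation `z` is differentiable along the trajectory if `z` depends in
a Lipschitz way on `x` and `g` represents its derivative. -/
theorem hasDerivAt_half_sq_norm {x v : ℝ → P} {z : ℝ → H} {g : P} {C t : ℝ} (ht : 0 < t)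
    (hx : HasDerivAt x (v t) t)
    (hz : ∀ s, 0 < s → ‖z s - z t‖ ≤ C * ‖x s - x t‖)
    (hg : ∀ s, 0 < s → ⟪z s - z t, z t⟫ = ⟪g, x s - x t⟫) :
    HasDerivAt (fun s => ‖z s‖ ^ 2 / 2) ⟪g, v t⟫ t := by
  have hpos : ∀ᶠ s in 𝓝 t, 0 < s := lt_mem_nhds ht
  have h1 : HasDerivAt (fun s => ⟪g, x s⟫) ⟪g, v t⟫ t := by
    simpa using (hasDerivAt_const t g).inner ℝ hx
  -- In the exact expansion of `‖z s‖² / 2` around `t` this is the remainder; the Lipschitz bound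
  -- makes it of order `(s - t)²`.
  have h2 : HasDerivAt (fun s => ‖z s - z t‖ ^ 2 / 2) 0 t := by
    rw [hasDerivAt_iff_isLittleO]
    have hO : (fun s => ‖z s - z t‖ ^ 2 / 2) =O[𝓝 t] fun s => (s - t) ^ 2 := by
      have hO1 : (fun s => z s - z t) =O[𝓝 t] fun s => s - t :=
        (Asymptotics.IsBigO.of_bound C (hpos.mono fun s hs => hz s hs)).trans hx.isBigO_sub
      have hO2 := (hO1.norm_left.pow 2).const_mul_left (1 / 2)
      exact hO2.congr_left fun s => by ring
    have hlo : (fun s : ℝ => (s - t) ^ 2) =o[𝓝 t] fun s => s - t := by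
      have h3 : Tendsto (fun s : ℝ => s - t) (𝓝 t) (𝓝 0) := by
        simpa using (continuous_sub_right t).tendsto t
      have h4 : (fun s : ℝ => s - t) =o[𝓝 t] fun _ => (1 : ℝ) :=
        (Asymptotics.isLittleO_one_iff ℝ).2 h3
      have h5 := h4.mul_isBigO (Asymptotics.isBigO_refl (fun s : ℝ => s - t) (𝓝 t))
      simpa [sq] using h5
    simpa using hO.trans_isLittleO hlo
  have h6 := ((h1.sub_const ⟪g, x t⟫).add h2).add_const (‖z t‖ ^ 2 / 2)
  rw [add_zero] at h6
  refine h6.congr_of_eventuallyEq (hpos.mono fun s hs => ?_)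
  have h7 := hg s hs
  rw [inner_sub_right, inner_sub_left, real_inner_self_eq_norm_sq] at h7
  have h8 := norm_sub_sq_real (z s) (z t)
  simp only [Pi.add_apply]
  linarith

/-- Weak convergence of the damped second order flow to a minimizer, in the real form of the coupled
complex boundary method. -/
theorem exists_weak_limit_of_soar [CompleteSpace P] [CompleteSpace T]
    (hBK : SplitsNorm B K) {J : T →L[ℝ] H}
    (hJB : ∀ x, J x = 0 → B x = 0) (hJκ : ∀ x, J x = 0 → κ x = 0)
    {η : ℝ} (hη : 0 < η) {ps : P} {p v a : ℝ → P}
    (hp : ∀ t, 0 < t → HasDerivAt p (v t) t) (hv : ∀ t, 0 < t → HasDerivAt v (a t) t)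
    (hstate : ∀ t, 0 < t → ∃ δ₁ δ₂ w₁ w₂ : T, CoupledState B K κ (p t - ps) δ₁ δ₂ ∧
      CoupledState B K J (J δ₂) w₁ w₂ ∧ a t + η • v t + κ w₂ = 0) :
    ∃ l, (∃ D, CoupledState B K κ (l - ps) D 0) ∧
      ∀ y, Tendsto (fun t => ⟪p t, y⟫) atTop (𝓝 ⟪l, y⟫) := by
  have hstate' : ∀ t, ∃ δ₁ δ₂ w₁ w₂ : T, 0 < t → CoupledState B K κ (p t - ps) δ₁ δ₂ ∧
      CoupledState B K J (J δ₂) w₁ w₂ ∧ a t + η • v t + κ w₂ = 0 := fun t => by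
    by_cases ht : 0 < t
    · obtain ⟨δ₁, δ₂, w₁, w₂, h⟩ := hstate t ht
      exact ⟨δ₁, δ₂, w₁, w₂, fun _ => h⟩
    · exact ⟨0, 0, 0, 0, fun h => absurd h ht⟩
  choose δ₁ δ₂ w₁ w₂ hs using hstate'
  -- Any exact source `l` can serve as the origin: its difference `D` is purely real, so the shift
  -- leaves `δ₂`, and hence the functional, unchanged.
  have hdiss : ∀ l D, CoupledState B K κ (l - ps) D 0 →
      Tendsto (fun t => ‖J (δ₂ t)‖ ^ 2 / 2) atTop (𝓝 0) ∧
        ∃ L, Tendsto (fun t => ‖p t - l‖ ^ 2) atTop (𝓝 L) := by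
    intro l D hD
    have hδ : ∀ t, 0 < t → CoupledState B K κ (p t - l) (δ₁ t - D) (δ₂ t) := fun t ht => by
      simpa using (hs t ht).1.sub hD
    refine tendsto_of_damped_system hη (fun t ht => (hp t ht).sub_const l) hv
      (fun t ht => (hs t ht).2.2) (fun t => by positivity) (fun t ht => ?_) (fun t ht => ?_)
    · refine hasDerivAt_half_sq_norm (x := p) (C := ‖J‖ * (2 * ‖κ‖)) ht (hp t ht)
        (fun s hs' => ?_) (fun s hs' => ?_)
      · rw [← map_sub, mul_assoc]
        refine (J.le_opNorm _).trans (mul_le_mul_of_nonneg_left ?_ (norm_nonneg J))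
        have h1 := ((hδ s hs').sub (hδ t ht)).norm_le hBK
        rw [sub_sub_sub_cancel_right, sub_sub_sub_cancel_right] at h1
        linarith [norm_nonneg (δ₁ s - δ₁ t)]
      · have h1 := ((hδ s hs').sub (hδ t ht)).reciprocity (hs t ht).2.1
        rw [sub_sub_sub_cancel_right] at h1
        rw [real_inner_comm, ← map_sub, ← h1, real_inner_comm]
    · rw [real_inner_comm, (hδ t ht).reciprocity (hs t ht).2.1, real_inner_self_eq_norm_sq]
      ring
  obtain ⟨hV, L, hL⟩ := hdiss ps 0 ⟨by simp, by simp⟩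
  obtain ⟨M, hM⟩ : ∃ M, ∀ᶠ t in atTop, ‖p t - ps‖ ≤ M := by
    refine ⟨√(L + 1), ?_⟩
    filter_upwards [hL.eventually (eventually_le_nhds (lt_add_one L))] with t ht
    exact Real.le_sqrt_of_sq_le ht
  have hlim : ∀ U : Ultrafilter ℝ, (U : Filter ℝ) ≤ atTop →
      ∃ l, (∃ D, CoupledState B K κ (l - ps) D 0) ∧
        ∀ y, Tendsto (fun t => ⟪p t, y⟫) U (𝓝 ⟪l, y⟫) := by
    intro U hU
    have hpos : ∀ᶠ t in (U : Filter ℝ), 0 < t := hU (eventually_gt_atTop 0)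
    have hbound : ∀ᶠ t in (U : Filter ℝ), ‖δ₁ t‖ + ‖δ₂ t‖ ≤ 2 * ‖κ‖ * M := by
      filter_upwards [hpos, hU hM] with t ht htM
      exact ((hs t ht).1.norm_le hBK).trans (mul_le_mul_of_nonneg_left htM (by positivity))
    obtain ⟨q, hq⟩ := exists_weak_limit_of_bounded U (hU hM)
    obtain ⟨D₁, hD₁⟩ := exists_weak_limit_of_bounded U
      (hbound.mono fun t ht => (le_add_of_nonneg_right (norm_nonneg (δ₂ t))).trans ht)
    obtain ⟨D₂, hD₂⟩ := exists_weak_limit_of_bounded U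
      (hbound.mono fun t ht => (le_add_of_nonneg_left (norm_nonneg (δ₁ t))).trans ht)
    have hre : ∀ ψ, ⟪B D₁, B ψ⟫ - ⟪K D₂, K ψ⟫ = ⟪q, κ ψ⟫ := fun ψ => by
      refine tendsto_nhds_unique (((tendsto_inner_map_of_weak hD₁ B (B ψ)).sub
        (tendsto_inner_map_of_weak hD₂ K (K ψ))).congr' ?_) (hq (κ ψ))
      exact hpos.mono fun t ht => (hs t ht).1.re_eq ψ
    have him : ∀ ψ, ⟪B D₂, B ψ⟫ + ⟪K D₁, K ψ⟫ = 0 := fun ψ => by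
      refine tendsto_nhds_unique (((tendsto_inner_map_of_weak hD₂ B (B ψ)).add
        (tendsto_inner_map_of_weak hD₁ K (K ψ))).congr' ?_) tendsto_const_nhds
      exact hpos.mono fun t ht => (hs t ht).1.im_eq ψ
    -- `J (δ₂ t)` tends to zero in norm, and its weak limit is `J D₂`.
    have hJ : J D₂ = 0 := by
      have h1 : Tendsto (fun t => ‖J (δ₂ t)‖) U (𝓝 0) := by
        have h2 := (hV.const_mul 2).sqrt
        simp only [mul_zero, Real.sqrt_zero] at h2
        refine (h2.mono_left hU).congr fun t => ?_
        rw [mul_div_cancel₀ _ two_ne_zero, Real.sqrt_sq (norm_nonneg _)]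
      have h3 : Tendsto (fun t => ⟪J (δ₂ t), J D₂⟫) U (𝓝 0) :=
        squeeze_zero_norm (fun t => norm_inner_le_norm _ _) (by simpa using h1.mul_const ‖J D₂‖)
      exact inner_self_eq_zero.1
        (tendsto_nhds_unique (tendsto_inner_map_of_weak hD₂ J (J D₂)) h3)
    have hBD₂ : B D₂ = 0 := hJB _ hJ
    -- Testing the real equation with `D₂` leaves only `-‖K D₂‖² = 0`. This replaces uniqueness of
    -- traces.
    have hKD₂ : K D₂ = 0 := by
      have h1 := hre D₂
      simpa [hBD₂, hJκ _ hJ] using h1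
    refine ⟨q + ps, ⟨D₁, ?_, ?_⟩, fun y => ?_⟩
    · intro ψ
      have h1 := hre ψ
      rw [hKD₂] at h1
      simpa using h1
    · intro ψ
      have h1 := him ψ
      rw [hBD₂] at h1
      simpa using h1
    · have h1 := (hq y).add_const ⟪ps, y⟫
      simpa only [← inner_add_left, sub_add_cancel] using h1
  obtain ⟨l, hl, hlw⟩ := hlim (Ultrafilter.of atTop) (Ultrafilter.of_le _)
  refine ⟨l, hl, fun y => ?_⟩
  rw [tendsto_iff_ultrafilter]
  intro U hU
  obtain ⟨l', hl', hlw'⟩ := hlim U hU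
  obtain ⟨D, hD⟩ := hl
  obtain ⟨D', hD'⟩ := hl'
  obtain ⟨L₁, hL₁⟩ := (hdiss l D hD).2
  obtain ⟨L₂, hL₂⟩ := (hdiss l' D' hD').2
  -- Opial's argument: the difference of the two convergent squared distances is affine in `⟪p t, l
  -- - l'⟫`, so this product has one limit for all ultrafilters.
  have hconv : Tendsto (fun t => ⟪p t, l - l'⟫) atTop
      (𝓝 ((L₂ - L₁ + (‖l‖ ^ 2 - ‖l'‖ ^ 2)) / 2)) := by
    refine (((hL₂.sub hL₁).add_const _).div_const 2).congr fun t => ?_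
    rw [norm_sub_sq_real, norm_sub_sq_real, inner_sub_right]
    ring
  have h1 := tendsto_nhds_unique (hlw (l - l')) (hconv.mono_left (Ultrafilter.of_le _))
  have h2 := tendsto_nhds_unique (hlw' (l - l')) (hconv.mono_left hU)
  have h3 : ⟪l - l', l - l'⟫ = 0 := by rw [inner_sub_left, h1, h2, sub_self]
  rw [sub_eq_zero.1 (inner_self_eq_zero.1 h3)]
  exact hlw' y

end Coupled

/-! ### Real-linear maps of the scalars acting on Sobolev functions and traces. -/

section ScalarMap

variable {𝕜 𝕜' : Type} [RCLike 𝕜] [RCLike 𝕜']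

/-- A real-linear map of the scalars, applied to the components of a vector. -/
def vecMap (A : 𝕜 →L[ℝ] 𝕜') : EuclideanSpace 𝕜 (Fin d) →L[ℝ] EuclideanSpace 𝕜' (Fin d) :=
  LinearMap.mkContinuous
    { toFun := fun z => WithLp.toLp 2 fun i => A (z i)
      map_add' := fun x y => by ext i; simp
      map_smul' := fun r x => by ext i; simp }
    ‖A‖ fun z => by
      rw [EuclideanSpace.norm_eq, EuclideanSpace.norm_eq]
      refine Real.sqrt_le_iff.2 ⟨by positivity, ?_⟩
      rw [mul_pow, Real.sq_sqrt (by positivity), Finset.mul_sum]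
      refine Finset.sum_le_sum fun i _ => ?_
      rw [← mul_pow]
      exact pow_le_pow_left₀ (norm_nonneg _) (A.le_opNorm _) 2

@[simp]
theorem vecMap_apply (A : 𝕜 →L[ℝ] 𝕜') (z : EuclideanSpace 𝕜 (Fin d)) (i : Fin d) :
    vecMap A z i = A (z i) := rfl

theorem grad_clm_comp (A : 𝕜 →L[ℝ] 𝕜') {φ : EuclideanSpace ℝ (Fin d) → 𝕜}
    (hφ : Differentiable ℝ φ) (x : EuclideanSpace ℝ (Fin d)) :
    grad (fun y => A (φ y)) x = vecMap A (grad φ x) := by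
  ext i
  have h : HasFDerivAt (fun y => A (φ y)) (A.comp (fderiv ℝ φ x)) x :=
    A.hasFDerivAt.comp x (hφ x).hasFDerivAt
  simp [grad, pderiv, h.fderiv]

theorem clm_ofReal_mul (A : 𝕜 →L[ℝ] 𝕜') (r : ℝ) (z : 𝕜) : A ((r : 𝕜) * z) = (r : 𝕜') * A z := by
  rw [← RCLike.real_smul_eq_coe_mul, map_smul, RCLike.real_smul_eq_coe_mul]

/-- A real-linear map of the scalars acts on `H¹`. -/
def h1map {G : Set (EuclideanSpace ℝ (Fin d))} (A : 𝕜 →L[ℝ] 𝕜') (u : H1 𝕜 G) : H1 𝕜' G :=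
  ⟨WithLp.toLp 2 (A.compLp (h1val u), (vecMap A).compLp (h1grad u)), by
    intro φ hφ i
    have h1 : ∫ x in G, ((pderiv i φ x : ℝ) : 𝕜') * A.compLp (h1val u) x =
        A (∫ x in G, ((pderiv i φ x : ℝ) : 𝕜) * h1val u x) := by
      rw [← A.integral_comp_comm (hφ.integrable_pderiv_mul i (Lp.memLp _))]
      refine integral_congr_ae ?_
      filter_upwards [A.coeFn_compLp (h1val u)] with x hx
      rw [hx, clm_ofReal_mul]
    have h2 : ∫ x in G, (φ x : 𝕜') * (vecMap A).compLp (h1grad u) x i =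
        A (∫ x in G, (φ x : 𝕜) * h1grad u x i) := by
      rw [← A.integral_comp_comm (hφ.integrable_mul ((h1grad u).memLp_apply i))]
      refine integral_congr_ae ?_
      filter_upwards [(vecMap A).coeFn_compLp (h1grad u)] with x hx
      rw [hx, vecMap_apply, clm_ofReal_mul]
    change ∫ x in G, ((pderiv i φ x : ℝ) : 𝕜') * A.compLp (h1val u) x =
      - ∫ x in G, (φ x : 𝕜') * (vecMap A).compLp (h1grad u) x i
    rw [h1, h2, show (∫ x in G, ((pderiv i φ x : ℝ) : 𝕜) * h1val u x) = _ from u.2 φ hφ i, map_neg]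
    rfl⟩

theorem h1val_h1map {G : Set (EuclideanSpace ℝ (Fin d))} (A : 𝕜 →L[ℝ] 𝕜') (u : H1 𝕜 G) :
    h1val (h1map A u) =ᵐ[volume.restrict G] fun x => A (h1val u x) :=
  A.coeFn_compLp (h1val u)

theorem h1grad_h1map {G : Set (EuclideanSpace ℝ (Fin d))} (A : 𝕜 →L[ℝ] 𝕜') (u : H1 𝕜 G) :
    h1grad (h1map A u) =ᵐ[volume.restrict G] fun x => vecMap A (h1grad u x) :=
  (vecMap A).coeFn_compLp (h1grad u)

theorem tendsto_eLpNorm_clm_sub {α E F : Type*} [MeasurableSpace α] {μ : Measure α}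
    [NormedAddCommGroup E] [NormedSpace ℝ E] [NormedAddCommGroup F] [NormedSpace ℝ F]
    (A : E →L[ℝ] F) {f : α → E} {f' : α → F} (hf : f' =ᵐ[μ] fun x => A (f x))
    {φ : ℕ → α → E} {φ' : ℕ → α → F} (hφ : ∀ n x, φ' n x = A (φ n x))
    (h : Tendsto (fun n => eLpNorm (fun x => f x - φ n x) 2 μ) atTop (𝓝 0)) :
    Tendsto (fun n => eLpNorm (fun x => f' x - φ' n x) 2 μ) atTop (𝓝 0) := by
  have h1 := ENNReal.Tendsto.const_mul (a := ENNReal.ofReal ‖A‖) h (Or.inr ENNReal.ofReal_ne_top)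
  rw [mul_zero] at h1
  refine tendsto_of_tendsto_of_tendsto_of_le_of_le tendsto_const_nhds h1
    (fun _ => bot_le) fun n => ?_
  refine eLpNorm_le_mul_eLpNorm_of_ae_le_mul (hf.mono fun x hx => ?_) 2
  simp only [hx, hφ, ← map_sub]
  exact A.le_opNorm _

theorem IsTrace.h1map {Ω : Set (EuclideanSpace ℝ (Fin d))} (A : 𝕜 →L[ℝ] 𝕜') {u : H1 𝕜 Ω}
    {τ : L2Bdry 𝕜 Ω} (h : IsTrace u τ) : IsTrace (h1map A u) (A.compLp τ) := by
  obtain ⟨φ, hφ, h1, h2, h3⟩ := h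
  refine ⟨fun n x => A (φ n x), fun n => A.contDiff.comp (hφ n),
    tendsto_eLpNorm_clm_sub A (h1val_h1map A u) (fun _ _ => rfl) h1,
    tendsto_eLpNorm_clm_sub (vecMap A) (h1grad_h1map A u) (fun n x => ?_) h2,
    tendsto_eLpNorm_clm_sub A (A.coeFn_compLp τ) (fun _ _ => rfl) h3⟩
  exact grad_clm_comp A ((hφ n).differentiable (by simp)) x

end ScalarMap

/-! ### The real Hilbert space `H¹`. -/

section RealSobolev

variable {G : Set (EuclideanSpace ℝ (Fin d))}

theorem continuous_integral_mul {α : Type*} [MeasurableSpace α] {μ : Measure α} {f : α → ℝ}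
    (hf : MemLp f 2 μ) : Continuous fun u : Lp ℝ 2 μ => ∫ x, f x * u x ∂μ := by
  have h : ∀ u : Lp ℝ 2 μ, ∫ x, f x * u x ∂μ = ⟪hf.toLp f, u⟫ := fun u => by
    rw [L2.inner_def]
    refine integral_congr_ae ?_
    filter_upwards [hf.coeFn_toLp] with x hx
    rw [hx, real_inner_eq_re_inner, RCLike.inner_apply]
    simp [mul_comm]
  simp only [h]
  exact continuous_const.inner continuous_id

theorem IsTestFunction.memLp {φ : EuclideanSpace ℝ (Fin d) → ℝ} (h : IsTestFunction G φ) :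
    MemLp φ 2 (volume.restrict G) :=
  (h.contDiff.continuous.memLp_of_hasCompactSupport (μ := volume) h.hasCompactSupport).restrict G

theorem IsTestFunction.memLp_pderiv {φ : EuclideanSpace ℝ (Fin d) → ℝ} (h : IsTestFunction G φ)
    (i : Fin d) : MemLp (pderiv i φ) 2 (volume.restrict G) := by
  have hc : Continuous (pderiv i φ) :=
    (h.contDiff.continuous_fderiv (by simp)).clm_apply continuous_const
  have hs : HasCompactSupport (pderiv i φ) :=
    h.hasCompactSupport.fderiv_apply (𝕜 := ℝ) (EuclideanSpace.single i 1)
  exact (hc.memLp_of_hasCompactSupport (μ := volume) hs).restrict G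

/-- Each test function and each component imposes one equation between continuous functionals of the
pair. -/
theorem isClosed_H1 : IsClosed (H1 ℝ G : Set (WithLp 2 (L2 ℝ G × L2Vec ℝ G))) := by
  have h : (H1 ℝ G : Set (WithLp 2 (L2 ℝ G × L2Vec ℝ G))) =
      ⋂ (φ) (_ : IsTestFunction G φ) (i : Fin d), {u | (∫ x in G, pderiv i φ x * u.fst x) =
        - ∫ x in G, φ x * (EuclideanSpace.proj (𝕜 := ℝ) i : _ →L[ℝ] ℝ).compLp u.snd x} := by
    ext u
    simp only [Set.mem_iInter, Set.mem_ofPred_eq]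
    refine forall_congr' fun φ => forall_congr' fun hφ => forall_congr' fun i => ?_
    have h1 : ∫ x in G, φ x * (EuclideanSpace.proj (𝕜 := ℝ) i : _ →L[ℝ] ℝ).compLp u.snd x =
        ∫ x in G, φ x * u.snd x i := by
      refine integral_congr_ae ?_
      filter_upwards [(EuclideanSpace.proj (𝕜 := ℝ) i : _ →L[ℝ] ℝ).coeFn_compLp u.snd] with x hx
      rw [hx]
      rfl
    rw [h1]
    rfl
  rw [h]
  refine isClosed_iInter fun φ => isClosed_iInter fun hφ => isClosed_iInter fun i =>
    isClosed_eq ?_ ?_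
  · exact (continuous_integral_mul (hφ.memLp_pderiv i)).comp (WithLp.fstL 2 ℝ (L2 ℝ G) (L2Vec ℝ G)).continuous
  · exact ((continuous_integral_mul hφ.memLp).comp
      (((EuclideanSpace.proj (𝕜 := ℝ) i : _ →L[ℝ] ℝ).compLpL 2 _).continuous.comp
        (WithLp.sndL 2 ℝ (L2 ℝ G) (L2Vec ℝ G)).continuous)).neg

instance : CompleteSpace (H1 ℝ G) := isClosed_H1.completeSpace_coe

/-- The embedding of `H¹` into `L²`. -/
def h1valL (G : Set (EuclideanSpace ℝ (Fin d))) : H1 ℝ G →L[ℝ] L2 ℝ G :=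
  (WithLp.fstL 2 ℝ _ _).comp (H1 ℝ G).subtypeL

/-- The weak gradient as an operator on `H¹`. -/
def h1gradL (G : Set (EuclideanSpace ℝ (Fin d))) : H1 ℝ G →L[ℝ] L2Vec ℝ G :=
  (WithLp.sndL 2 ℝ _ _).comp (H1 ℝ G).subtypeL

theorem integrable_h1_inner (u v : H1 ℝ G) :
    Integrable (fun x => (∑ i, h1grad u x i * h1grad v x i) + h1val u x * h1val v x)
      (volume.restrict G) := by
  have h1 := (L2.integrable_inner (𝕜 := ℝ) (h1grad u) (h1grad v)).add
    (L2.integrable_inner (𝕜 := ℝ) (h1val u) (h1val v))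
  refine h1.congr (Eventually.of_forall fun x => ?_)
  simp [PiLp.inner_apply, mul_comm]

theorem h1_inner (u v : H1 ℝ G) :
    ⟪u, v⟫ = ∫ x in G, ((∑ i, h1grad u x i * h1grad v x i) + h1val u x * h1val v x) := by
  have h1 : ⟪u, v⟫ = ⟪h1val u, h1val v⟫ + ⟪h1grad u, h1grad v⟫ := rfl
  rw [h1, L2.inner_def, L2.inner_def, add_comm,
    ← integral_add (L2.integrable_inner _ _) (L2.integrable_inner _ _)]
  refine integral_congr_ae (Eventually.of_forall fun x => ?_)
  simp [PiLp.inner_apply, mul_comm]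

theorem L2_inner {α : Type*} [MeasurableSpace α] {μ : Measure α} (f g : Lp ℝ 2 μ) :
    ⟪f, g⟫ = ∫ x, f x * g x ∂μ := by
  rw [L2.inner_def]
  refine integral_congr_ae (Eventually.of_forall fun x => ?_)
  simp [mul_comm]

/-- Uniqueness of the weak gradient. -/
theorem eq_zero_of_h1val_eq_zero (hG : IsOpen G) {u : H1 ℝ G} (hu : h1val u = 0) : u = 0 := by
  have hg : h1grad u = 0 := by
    have h1 : ∀ i, ∀ᵐ x ∂(volume.restrict G), h1grad u x i = 0 := fun i => by
      rw [ae_restrict_iff' hG.measurableSet]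
      -- Fundamental lemma of the calculus of variations, applied to each component of the gradient.
      refine hG.ae_eq_zero_of_integral_contDiff_smul_eq_zero
        (locallyIntegrableOn_of_locallyIntegrable_restrict
          (((h1grad u).memLp_apply i).locallyIntegrable (by norm_num))) fun φ h1 h2 h3 => ?_
      have h4 := u.2 φ ⟨h1, h2, h3⟩ i
      have h5 : ∫ x in G, pderiv i φ x * h1val u x = 0 := by
        rw [hu]
        refine (integral_congr_ae ?_).trans (integral_zero _ _)
        filter_upwards [Lp.coeFn_zero ℝ 2 (volume.restrict G)] with x hx
        rw [hx, Pi.zero_apply, mul_zero]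
      have h6 : ∫ x in G, φ x * h1grad u x i = 0 := neg_eq_zero.1 (h4.symm.trans h5)
      rw [← h6, setIntegral_eq_integral_of_forall_compl_eq_zero fun x hx => ?_]
      · rfl
      · rw [image_eq_zero_of_notMem_tsupport fun h => hx (h3 h), zero_mul]
    refine Lp.ext ?_
    filter_upwards [ae_all_iff.2 h1, Lp.coeFn_zero (EuclideanSpace ℝ (Fin d)) 2
      (volume.restrict G)] with x hx hx0
    rw [hx0]
    ext i
    exact hx i
  refine Subtype.ext ((WithLp.equiv 2 _).injective (Prod.ext hu hg))

/-- Restriction of `L²` functions to a smaller set. -/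
def restrictL {G₀ : Set (EuclideanSpace ℝ (Fin d))} (h : G₀ ⊆ G) : L2 ℝ G →L[ℝ] L2 ℝ G₀ :=
  LinearMap.mkContinuous
    { toFun := fun f => ((Lp.memLp f).mono_measure (Measure.restrict_mono h le_rfl)).toLp f
      map_add' := fun f g => by
        rw [← MemLp.toLp_add]
        exact MemLp.toLp_congr _ _ (ae_restrict_of_ae_restrict_of_subset h (Lp.coeFn_add f g))
      map_smul' := fun r f => by
        rw [RingHom.id_apply, ← MemLp.toLp_const_smul]
        exact MemLp.toLp_congr _ _ (ae_restrict_of_ae_restrict_of_subset h (Lp.coeFn_smul r f)) }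
    1 fun f => by
      rw [one_mul, LinearMap.coe_mk, AddHom.coe_mk, Lp.norm_toLp, Lp.norm_def]
      exact ENNReal.toReal_mono (Lp.eLpNorm_ne_top f)
        (eLpNorm_mono_measure _ (Measure.restrict_mono h le_rfl))

theorem restrictL_ae {G₀ : Set (EuclideanSpace ℝ (Fin d))} (h : G₀ ⊆ G) (f : L2 ℝ G) :
    restrictL h f =ᵐ[volume.restrict G₀] f :=
  ((Lp.memLp f).mono_measure (Measure.restrict_mono h le_rfl)).coeFn_toLp

end RealSobolev

/-! ### The Hilbert space of functions paired with a trace. -/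

section TraceSpace

variable {Ω : Set (EuclideanSpace ℝ (Fin d))}

theorem continuous_grad {φ : EuclideanSpace ℝ (Fin d) → ℝ} (hφ : ContDiff ℝ ∞ φ) :
    Continuous (grad φ) := by
  refine (PiLp.continuous_toLp 2 _).comp (continuous_pi fun i => ?_)
  exact (hφ.continuous_fderiv (by simp)).clm_apply continuous_const

theorem grad_add {φ ψ : EuclideanSpace ℝ (Fin d) → ℝ} (hφ : ContDiff ℝ ∞ φ)
    (hψ : ContDiff ℝ ∞ ψ) : grad (φ + ψ) = grad φ + grad ψ := by
  ext x i
  simp [grad, pderiv, fderiv_add (hφ.differentiable (by simp) x) (hψ.differentiable (by simp) x)]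

theorem grad_smul (r : ℝ) {φ : EuclideanSpace ℝ (Fin d) → ℝ} (hφ : ContDiff ℝ ∞ φ) :
    grad (r • φ) = r • grad φ := by
  ext x i
  simp [grad, pderiv, fderiv_const_smul (hφ.differentiable (by simp) x)]

/-- The triples consisting of a smooth function, its gradient and its boundary values. -/
def smoothTriples (Ω : Set (EuclideanSpace ℝ (Fin d))) :
    Submodule ℝ (L2 ℝ Ω × L2Vec ℝ Ω × L2Bdry ℝ Ω) where
  carrier := {x | ∃ φ : EuclideanSpace ℝ (Fin d) → ℝ, ContDiff ℝ ∞ φ ∧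
    x.1 =ᵐ[volume.restrict Ω] φ ∧ x.2.1 =ᵐ[volume.restrict Ω] grad φ ∧ x.2.2 =ᵐ[surface Ω] φ}
  zero_mem' := ⟨0, contDiff_const, Lp.coeFn_zero _ _ _, by
    have h : grad (0 : EuclideanSpace ℝ (Fin d) → ℝ) = 0 := by
      ext x i
      simp [grad, pderiv]
    rw [h]
    exact Lp.coeFn_zero _ _ _, Lp.coeFn_zero _ _ _⟩
  add_mem' := by
    rintro x y ⟨φ, hφ, h1, h2, h3⟩ ⟨ψ, hψ, k1, k2, k3⟩
    refine ⟨φ + ψ, hφ.add hψ, (Lp.coeFn_add _ _).trans (h1.add k1), ?_,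
      (Lp.coeFn_add _ _).trans (h3.add k3)⟩
    rw [grad_add hφ hψ]
    exact (Lp.coeFn_add _ _).trans (h2.add k2)
  smul_mem' := by
    rintro r x ⟨φ, hφ, h1, h2, h3⟩
    refine ⟨r • φ, contDiff_const.smul hφ, (Lp.coeFn_smul _ _).trans (h1.const_smul r), ?_,
      (Lp.coeFn_smul _ _).trans (h3.const_smul r)⟩
    rw [grad_smul r hφ]
    exact (Lp.coeFn_smul _ _).trans (h2.const_smul r)

theorem eLpNorm_sub_eq_edist {α E : Type*} [MeasurableSpace α] {μ : Measure α}
    [NormedAddCommGroup E] (f g : Lp E 2 μ) {φ : α → E} (h : g =ᵐ[μ] φ) :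
    eLpNorm (fun x => f x - φ x) 2 μ = edist f g := by
  rw [Lp.edist_def]
  refine eLpNorm_congr_ae ?_
  filter_upwards [h] with x hx
  rw [Pi.sub_apply, hx]

/-- Being at finite distance from an `L²` function forces `φ` into `L²`; finiteness of `μ` is not
needed. -/
theorem exists_Lp_of_eLpNorm_sub_lt {α E : Type*} [MeasurableSpace α] {μ : Measure α}
    [NormedAddCommGroup E] {f : Lp E 2 μ} {φ : α → E} (hφ : AEStronglyMeasurable φ μ)
    {ε : ℝ≥0∞} (h : eLpNorm (fun x => f x - φ x) 2 μ < ε) :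
    ∃ g : Lp E 2 μ, g =ᵐ[μ] φ ∧ edist f g < ε := by
  have h1 : MemLp (fun x => f x - φ x) 2 μ :=
    ⟨(Lp.aestronglyMeasurable f).sub hφ, h.trans_le le_top⟩
  have h2 : MemLp φ 2 μ := by
    refine ((Lp.memLp f).sub h1).ae_eq (Eventually.of_forall fun x => ?_)
    simp
  refine ⟨h2.toLp φ, h2.coeFn_toLp, ?_⟩
  rwa [← eLpNorm_sub_eq_edist f _ h2.coeFn_toLp]

/-- Makes the trace relation a closed linear one, so that pairs form a Hilbert space without
existence, uniqueness or continuity of traces. -/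
theorem isTrace_iff_mem_closure {u : H1 ℝ Ω} {τ : L2Bdry ℝ Ω} :
    IsTrace u τ ↔ (h1val u, h1grad u, τ) ∈ (smoothTriples Ω).topologicalClosure := by
  rw [← SetLike.mem_coe, Submodule.topologicalClosure_coe]
  constructor
  · rintro ⟨φ, hφ, h1, h2, h3⟩
    rw [EMetric.mem_closure_iff]
    intro ε hε
    obtain ⟨n, hn1, hn2, hn3⟩ := ((h1.eventually (gt_mem_nhds hε)).and
      ((h2.eventually (gt_mem_nhds hε)).and (h3.eventually (gt_mem_nhds hε)))).exists
    obtain ⟨a, ha, ha'⟩ :=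
      exists_Lp_of_eLpNorm_sub_lt (hφ n).continuous.aestronglyMeasurable hn1
    obtain ⟨b, hb, hb'⟩ :=
      exists_Lp_of_eLpNorm_sub_lt (continuous_grad (hφ n)).aestronglyMeasurable hn2
    obtain ⟨c, hc, hc'⟩ :=
      exists_Lp_of_eLpNorm_sub_lt (hφ n).continuous.aestronglyMeasurable hn3
    refine ⟨(a, b, c), ⟨φ n, hφ n, ha, hb, hc⟩, ?_⟩
    rw [Prod.edist_eq, Prod.edist_eq]
    exact max_lt ha' (max_lt hb' hc')
  · intro h
    obtain ⟨x, hx, hlim⟩ := mem_closure_iff_seq_limit.1 h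
    choose φ hφ h1 h2 h3 using hx
    refine ⟨φ, hφ, ?_, ?_, ?_⟩
    · simp only [eLpNorm_sub_eq_edist _ _ (h1 _)]
      simpa only [edist_comm] using tendsto_iff_edist_tendsto_0.1 hlim.fst_nhds
    · simp only [eLpNorm_sub_eq_edist _ _ (h2 _)]
      simpa only [edist_comm] using tendsto_iff_edist_tendsto_0.1 hlim.snd_nhds.fst_nhds
    · simp only [eLpNorm_sub_eq_edist _ _ (h3 _)]
      simpa only [edist_comm] using tendsto_iff_edist_tendsto_0.1 hlim.snd_nhds.snd_nhds

/-- The components of a pair of an element of `L² × (L²)^d` and a boundary function. -/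
def tripleL (Ω : Set (EuclideanSpace ℝ (Fin d))) :
    WithLp 2 (WithLp 2 (L2 ℝ Ω × L2Vec ℝ Ω) × L2Bdry ℝ Ω) →L[ℝ]
      L2 ℝ Ω × L2Vec ℝ Ω × L2Bdry ℝ Ω :=
  ((WithLp.fstL 2 ℝ (L2 ℝ Ω) (L2Vec ℝ Ω)).comp (WithLp.fstL 2 ℝ _ _)).prod
    (((WithLp.sndL 2 ℝ (L2 ℝ Ω) (L2Vec ℝ Ω)).comp (WithLp.fstL 2 ℝ _ _)).prod
      (WithLp.sndL 2 ℝ _ _))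

/-- The pairs of a real `H¹` function and one of its traces. -/
def traceSubmodule (Ω : Set (EuclideanSpace ℝ (Fin d))) :
    Submodule ℝ (WithLp 2 (WithLp 2 (L2 ℝ Ω × L2Vec ℝ Ω) × L2Bdry ℝ Ω)) :=
  (H1 ℝ Ω).comap (WithLp.fstL 2 ℝ _ _).toLinearMap ⊓
    (smoothTriples Ω).topologicalClosure.comap (tripleL Ω).toLinearMap

theorem isClosed_traceSubmodule :
    IsClosed (traceSubmodule Ω : Set (WithLp 2 (WithLp 2 (L2 ℝ Ω × L2Vec ℝ Ω) × L2Bdry ℝ Ω))) :=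
  (isClosed_H1.preimage (WithLp.fstL 2 ℝ _ _).continuous).inter
    ((smoothTriples Ω).isClosed_topologicalClosure.preimage (tripleL Ω).continuous)

/-- The Hilbert space of the pairs of a real `H¹` function and one of its traces. -/
def TraceSpace (Ω : Set (EuclideanSpace ℝ (Fin d))) : Type := traceSubmodule Ω

instance : NormedAddCommGroup (TraceSpace Ω) :=
  inferInstanceAs (NormedAddCommGroup (traceSubmodule Ω))

instance : InnerProductSpace ℝ (TraceSpace Ω) :=
  inferInstanceAs (InnerProductSpace ℝ (traceSubmodule Ω))

instance : CompleteSpace (TraceSpace Ω) := isClosed_traceSubmodule.completeSpace_coe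

/-- The pair of a function and its trace. -/
def IsTrace.pair {u : H1 ℝ Ω} {τ : L2Bdry ℝ Ω} (h : IsTrace u τ) : TraceSpace Ω :=
  (⟨WithLp.toLp 2 (u, τ), u.2, isTrace_iff_mem_closure.1 h⟩ : traceSubmodule Ω)

/-- The inclusion of the trace pairs into the triples of functions, gradients and boundary
functions. -/
def traceIncl (Ω : Set (EuclideanSpace ℝ (Fin d))) :
    TraceSpace Ω →L[ℝ] WithLp 2 (WithLp 2 (L2 ℝ Ω × L2Vec ℝ Ω) × L2Bdry ℝ Ω) :=
  (traceSubmodule Ω).subtypeL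

/-- The function of a trace pair. -/
def traceFst (Ω : Set (EuclideanSpace ℝ (Fin d))) : TraceSpace Ω →L[ℝ] H1 ℝ Ω :=
  ((WithLp.fstL 2 ℝ _ _).comp (traceIncl Ω)).codRestrict (H1 ℝ Ω) fun x => x.2.1

/-- The trace of a trace pair. -/
def traceSnd (Ω : Set (EuclideanSpace ℝ (Fin d))) : TraceSpace Ω →L[ℝ] L2Bdry ℝ Ω :=
  (WithLp.sndL 2 ℝ _ _).comp (traceIncl Ω)

theorem isTrace_traceFst_traceSnd (x : TraceSpace Ω) : IsTrace (traceFst Ω x) (traceSnd Ω x) :=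
  isTrace_iff_mem_closure.2 x.2.2

theorem splitsNorm_traceSpace : SplitsNorm (traceFst Ω) (traceSnd Ω) := fun x =>
  WithLp.prod_norm_sq_eq_of_L2 (traceIncl Ω x)

end TraceSpace

/-! ### From the boundary value problems to the abstract coupled system. -/

section Reduction

variable {Ω Ω₀ : Set (EuclideanSpace ℝ (Fin d))}

theorem integrable_L2_mul {α : Type*} [MeasurableSpace α] {μ : Measure α} (f g : Lp ℝ 2 μ) :
    Integrable (fun x => f x * g x) μ :=
  (Lp.memLp f).integrable_mul (Lp.memLp g)

theorem integral_ofReal_add_I_mul {α : Type*} [MeasurableSpace α] {μ : Measure α} {f g : α → ℝ}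
    (hf : Integrable f μ) (hg : Integrable g μ) :
    ∫ x, ((f x : ℂ) + Complex.I * (g x : ℂ)) ∂μ =
      ((∫ x, f x ∂μ : ℝ) : ℂ) + Complex.I * ((∫ x, g x ∂μ : ℝ) : ℂ) := by
  rw [integral_add hf.ofReal (hg.ofReal.const_mul _), integral_const_mul, integral_complex_ofReal,
    integral_complex_ofReal]

theorem complex_mul_star_ofReal (z : ℂ) (r : ℝ) :
    z * star (r : ℂ) = ((z.re * r : ℝ) : ℂ) + Complex.I * ((z.im * r : ℝ) : ℂ) := by
  apply Complex.ext <;> simp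

/-- The Robin form against a real test function. -/
theorem robinForm_ofReal (u : H1 ℂ Ω) (τ : L2Bdry ℂ Ω) (ψ : H1 ℝ Ω) (θ : L2Bdry ℝ Ω) :
    robinForm u τ (h1map Complex.ofRealCLM ψ) (Complex.ofRealCLM.compLp θ) =
      ((⟪h1map Complex.reCLM u, ψ⟫ - ⟪Complex.imCLM.compLp τ, θ⟫ : ℝ) : ℂ) +
        Complex.I * ((⟪h1map Complex.imCLM u, ψ⟫ + ⟪Complex.reCLM.compLp τ, θ⟫ : ℝ) : ℂ) := by
  have h1 : ∫ x in Ω, ((∑ i, h1grad u x i * star (h1grad (h1map Complex.ofRealCLM ψ) x i)) +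
      h1val u x * star (h1val (h1map Complex.ofRealCLM ψ) x)) =
        ((⟪h1map Complex.reCLM u, ψ⟫ : ℝ) : ℂ) +
          Complex.I * ((⟪h1map Complex.imCLM u, ψ⟫ : ℝ) : ℂ) := by
    rw [h1_inner, h1_inner, ← integral_ofReal_add_I_mul (integrable_h1_inner _ _)
      (integrable_h1_inner _ _)]
    refine integral_congr_ae ?_
    filter_upwards [h1val_h1map Complex.ofRealCLM ψ, h1grad_h1map Complex.ofRealCLM ψ,
      h1val_h1map Complex.reCLM u, h1grad_h1map Complex.reCLM u,
      h1val_h1map Complex.imCLM u, h1grad_h1map Complex.imCLM u] with x e1 e2 e3 e4 e5 e6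
    simp only [e1, e2, e3, e4, e5, e6, vecMap_apply, Complex.ofRealCLM_apply, Complex.reCLM_apply,
      Complex.imCLM_apply, complex_mul_star_ofReal, Finset.sum_add_distrib, ← Finset.mul_sum,
      Complex.ofReal_add, Complex.ofReal_sum]
    ring
  have h2 : ∫ x, τ x * star (Complex.ofRealCLM.compLp θ x) ∂(surface Ω) =
      ((⟪Complex.reCLM.compLp τ, θ⟫ : ℝ) : ℂ) +
        Complex.I * ((⟪Complex.imCLM.compLp τ, θ⟫ : ℝ) : ℂ) := by
    rw [L2_inner, L2_inner, ← integral_ofReal_add_I_mul (integrable_L2_mul _ _)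
      (integrable_L2_mul _ _)]
    refine integral_congr_ae ?_
    filter_upwards [Complex.ofRealCLM.coeFn_compLp θ, Complex.reCLM.coeFn_compLp τ,
      Complex.imCLM.coeFn_compLp τ] with x e1 e2 e3
    simp only [e1, e2, e3, Complex.ofRealCLM_apply, Complex.reCLM_apply, Complex.imCLM_apply,
      complex_mul_star_ofReal]
  rw [robinForm, h1, h2]
  rw [Complex.ofReal_sub, Complex.ofReal_add]
  -- The factor `I` of the boundary term meets the `I` of the imaginary part of `τ`; this is the
  -- source of the minus sign in `CoupledState.re_eq`.
  linear_combination ((⟪Complex.imCLM.compLp τ, θ⟫ : ℝ) : ℂ) * Complex.I_sq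

theorem integral_ofReal_mul_star {α : Type*} [MeasurableSpace α] {μ : Measure α} (f : α → ℝ)
    {h : α → ℂ} {g : α → ℝ} (hg : h =ᵐ[μ] fun x => Complex.ofRealCLM (g x)) :
    ∫ x, (f x : ℂ) * star (h x) ∂μ = ((∫ x, f x * g x ∂μ : ℝ) : ℂ) := by
  rw [← integral_complex_ofReal]
  refine integral_congr_ae ?_
  filter_upwards [hg] with x hx
  rw [hx, Complex.ofRealCLM_apply, complex_mul_star_ofReal]
  simp

theorem ofReal_add_I_mul_inj {a b c e : ℝ}
    (h : (a : ℂ) + Complex.I * (b : ℂ) = (c : ℂ) + Complex.I * (e : ℂ)) : a = c ∧ b = e := by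
  have h1 := congrArg Complex.re h
  have h2 := congrArg Complex.im h
  simp at h1 h2
  exact ⟨h1, h2⟩

theorem add_zero_I_mul (c : ℝ) : (c : ℂ) + Complex.I * ((0 : ℝ) : ℂ) = c := by
  rw [Complex.ofReal_zero, mul_zero, add_zero]

/-- Real test functions, embedded in the complex space, already yield the two real equations as real
and imaginary parts. -/
theorem isState_real_test (hsub : Ω₀ ⊆ Ω) {g₁ g₂ : EuclideanSpace ℝ (Fin d) → ℝ}
    {f : L2 ℝ Ω₀} {u : H1 ℂ Ω} {τ : L2Bdry ℂ Ω}
    (hu : ∀ (ψ : H1 ℂ Ω) (θ : L2Bdry ℂ Ω), IsTrace ψ θ →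
      robinForm u τ ψ θ = (∫ x in Ω₀, (f x : ℂ) * star (h1val ψ x))
        + (∫ x, (g₂ x : ℂ) * star (θ x) ∂(surface Ω))
        + Complex.I * ∫ x, (g₁ x : ℂ) * star (θ x) ∂(surface Ω))
    {ψ : H1 ℝ Ω} {θ : L2Bdry ℝ Ω} (hψ : IsTrace ψ θ) :
    ⟪h1map Complex.reCLM u, ψ⟫ - ⟪Complex.imCLM.compLp τ, θ⟫ =
        (∫ x in Ω₀, f x * h1val ψ x) + (∫ x, g₂ x * θ x ∂(surface Ω)) ∧
      ⟪h1map Complex.imCLM u, ψ⟫ + ⟪Complex.reCLM.compLp τ, θ⟫ =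
        ∫ x, g₁ x * θ x ∂(surface Ω) := by
  have h1 := hu _ _ (hψ.h1map Complex.ofRealCLM)
  rw [robinForm_ofReal, integral_ofReal_mul_star _ (ae_restrict_of_ae_restrict_of_subset hsub
    (h1val_h1map Complex.ofRealCLM ψ)), integral_ofReal_mul_star _
    (Complex.ofRealCLM.coeFn_compLp θ), integral_ofReal_mul_star _
    (Complex.ofRealCLM.coeFn_compLp θ), ← Complex.ofReal_add] at h1
  exact ofReal_add_I_mul_inj h1

theorem isAdjointState_real_test {u w : H1 ℂ Ω} {τ : L2Bdry ℂ Ω}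
    (hw : ∀ (ψ : H1 ℂ Ω) (θ : L2Bdry ℂ Ω), IsTrace ψ θ →
      robinForm w τ ψ θ = ∫ x in Ω, ((h1val u x).im : ℂ) * star (h1val ψ x))
    {ψ : H1 ℝ Ω} {θ : L2Bdry ℝ Ω} (hψ : IsTrace ψ θ) :
    ⟪h1map Complex.reCLM w, ψ⟫ - ⟪Complex.imCLM.compLp τ, θ⟫ =
        ⟪h1val (h1map Complex.imCLM u), h1val ψ⟫ ∧
      ⟪h1map Complex.imCLM w, ψ⟫ + ⟪Complex.reCLM.compLp τ, θ⟫ = 0 := by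
  have h1 := hw _ _ (hψ.h1map Complex.ofRealCLM)
  rw [robinForm_ofReal, integral_ofReal_mul_star _ (h1val_h1map Complex.ofRealCLM _)] at h1
  obtain ⟨h2, h3⟩ := ofReal_add_I_mul_inj (h1.trans (add_zero_I_mul _).symm)
  refine ⟨h2.trans ?_, h3⟩
  rw [L2_inner]
  exact integral_congr_ae ((h1val_h1map Complex.imCLM u).symm.mul .rfl)

/-- The difference of the state and of a real solution of the overdetermined problem solves the
coupled system. -/
theorem coupledState_of_isState {P : Type} [NormedAddCommGroup P] [InnerProductSpace ℝ P]
    (hsub : Ω₀ ⊆ Ω) {κ : TraceSpace Ω →L[ℝ] P} {ι : P →L[ℝ] L2 ℝ Ω₀}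
    (hκ : ∀ q ψ, ⟪q, κ ψ⟫ = ∫ x in Ω₀, ι q x * h1val (traceFst Ω ψ) x)
    {g₁ g₂ : EuclideanSpace ℝ (Fin d) → ℝ} {p ps : P} {u : H1 ℂ Ω} {τ : L2Bdry ℂ Ω}
    (hτ : IsTrace u τ)
    (hu : ∀ (ψ : H1 ℂ Ω) (θ : L2Bdry ℂ Ω), IsTrace ψ θ →
      robinForm u τ ψ θ = (∫ x in Ω₀, (ι p x : ℂ) * star (h1val ψ x))
        + (∫ x, (g₂ x : ℂ) * star (θ x) ∂(surface Ω))
        + Complex.I * ∫ x, (g₁ x : ℂ) * star (θ x) ∂(surface Ω))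
    {us : H1 ℝ Ω} {τs : L2Bdry ℝ Ω} (hτs : IsTrace us τs) (hg₁ : τs =ᵐ[surface Ω] g₁)
    (hus : ∀ (ψ : H1 ℝ Ω) (θ : L2Bdry ℝ Ω), IsTrace ψ θ →
      (∫ x in Ω, ((∑ i, h1grad us x i * h1grad ψ x i) + h1val us x * h1val ψ x))
        = (∫ x in Ω₀, ι ps x * h1val ψ x) + ∫ x, g₂ x * θ x ∂(surface Ω)) :
    CoupledState (traceFst Ω) (traceSnd Ω) κ (p - ps)
      ((hτ.h1map Complex.reCLM).pair - hτs.pair) (hτ.h1map Complex.imCLM).pair := by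
  refine CoupledState.of_sub (r := fun ψ => ∫ x in Ω₀, ι p x * h1val (traceFst Ω ψ) x)
    (r' := fun ψ => ∫ x in Ω₀, ι ps x * h1val (traceFst Ω ψ) x)
    (g := fun ψ => ∫ x, g₂ x * traceSnd Ω ψ x ∂(surface Ω)) (hκ p) (hκ ps)
    (fun ψ => (isState_real_test hsub hu (isTrace_traceFst_traceSnd ψ)).1)
    (fun ψ => (h1_inner _ _).trans (hus _ _ (isTrace_traceFst_traceSnd ψ)))
    (fun ψ => (isState_real_test hsub hu (isTrace_traceFst_traceSnd ψ)).2.trans ?_)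
  refine Eq.trans ?_ (L2_inner τs (traceSnd Ω ψ)).symm
  exact integral_congr_ae (hg₁.symm.mul .rfl)

theorem coupledState_of_isAdjointState {u w : H1 ℂ Ω} {τ : L2Bdry ℂ Ω} (hτ : IsTrace w τ)
    (hw : ∀ (ψ : H1 ℂ Ω) (θ : L2Bdry ℂ Ω), IsTrace ψ θ →
      robinForm w τ ψ θ = ∫ x in Ω, ((h1val u x).im : ℂ) * star (h1val ψ x)) :
    CoupledState (traceFst Ω) (traceSnd Ω) ((h1valL Ω).comp (traceFst Ω))
      (h1val (h1map Complex.imCLM u)) (hτ.h1map Complex.reCLM).pair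
      (hτ.h1map Complex.imCLM).pair := by
  constructor
  · exact fun ψ => (isAdjointState_real_test hw (isTrace_traceFst_traceSnd ψ)).1
  · exact fun ψ => (isAdjointState_real_test hw (isTrace_traceFst_traceSnd ψ)).2

theorem weaklyTendsto_of_inner {P : Type} [NormedAddCommGroup P] [InnerProductSpace ℝ P]
    [CompleteSpace P] {p : ℝ → P} {l : P}
    (h : ∀ y, Tendsto (fun t => ⟪p t, y⟫) atTop (𝓝 ⟪l, y⟫)) : WeaklyTendsto p l := by
  refine (WeakBilin.tendsto_iff_forall_eval_tendsto (topDualPairing ℝ P).flip ?_).2 fun f => ?_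
  -- Continuous functionals separate points, so the pairing defining the weak topology is injective.
  · intro x y h
    exact (SeparatingDual.eq_iff_forall_dual_eq (R := ℝ)).2 fun f => LinearMap.congr_fun h f
  · have h1 : ∀ x, f x = ⟪x, (InnerProductSpace.toDual ℝ P).symm f⟫ := fun x => by
      rw [real_inner_comm, InnerProductSpace.toDual_symm_apply]
    change Tendsto (fun t => f (p t)) atTop (𝓝 (f l))
    simpa only [h1] using h _

variable {P : Type} [NormedAddCommGroup P] [InnerProductSpace ℝ P] [CompleteSpace P]

/-- The Riesz representative in the source space of the pairing of a function with the sources. -/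
def sourceL (hsub : Ω₀ ⊆ Ω) (ι : P →L[ℝ] L2 ℝ Ω₀) : L2 ℝ Ω →L[ℝ] P :=
  (ContinuousLinearMap.adjoint ι).comp (restrictL hsub)

theorem inner_sourceL (hsub : Ω₀ ⊆ Ω) (ι : P →L[ℝ] L2 ℝ Ω₀) (q : P) (f : L2 ℝ Ω) :
    ⟪q, sourceL hsub ι f⟫ = ∫ x in Ω₀, ι q x * f x := by
  rw [sourceL, ContinuousLinearMap.comp_apply, ContinuousLinearMap.adjoint_inner_right, L2_inner]
  exact integral_congr_ae (EventuallyEq.rfl.mul (restrictL_ae hsub _))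

/-- Turns the tested evolution equation into an equation in `P`, with gradient given by the Riesz
representative. -/
theorem add_sourceL_eq_zero (hsub : Ω₀ ⊆ Ω) (ι : P →L[ℝ] L2 ℝ Ω₀) {b : P} {w : H1 ℂ Ω}
    (h : ∀ q : P, ⟪b, q⟫ + ∫ x in Ω₀, (h1val w x).im * ι q x = 0) :
    b + sourceL hsub ι (h1val (h1map Complex.imCLM w)) = 0 := by
  refine ext_inner_right ℝ fun q => ?_
  rw [inner_add_left, inner_zero_left, ← h q, add_right_inj, real_inner_comm, inner_sourceL]
  refine integral_congr_ae ?_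
  filter_upwards [ae_restrict_of_ae_restrict_of_subset hsub
    (h1val_h1map Complex.imCLM w)] with x hx
  rw [mul_comm]
  exact congrArg (· * ι q x) hx

/-- The value of a trace pair. -/
def traceVal (Ω : Set (EuclideanSpace ℝ (Fin d))) : TraceSpace Ω →L[ℝ] L2 ℝ Ω :=
  (h1valL Ω).comp (traceFst Ω)

theorem traceFst_eq_zero (hΩ : IsOpen Ω) {x : TraceSpace Ω} (hx : traceVal Ω x = 0) :
    traceFst Ω x = 0 :=
  eq_zero_of_h1val_eq_zero hΩ hx

theorem sourceL_comp_eq_zero (hsub : Ω₀ ⊆ Ω) (ι : P →L[ℝ] L2 ℝ Ω₀) {x : TraceSpace Ω}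
    (hx : traceVal Ω x = 0) : (sourceL hsub ι).comp (traceVal Ω) x = 0 := by
  rw [ContinuousLinearMap.comp_apply, hx, map_zero]

theorem inner_sourceL_comp (hsub : Ω₀ ⊆ Ω) (ι : P →L[ℝ] L2 ℝ Ω₀) (q : P) (ψ : TraceSpace Ω) :
    ⟪q, (sourceL hsub ι).comp (traceVal Ω) ψ⟫ = ∫ x in Ω₀, ι q x * h1val (traceFst Ω ψ) x :=
  inner_sourceL hsub ι q _

theorem exists_coupledState (hsub : Ω₀ ⊆ Ω) (ι : P →L[ℝ] L2 ℝ Ω₀)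
    {g₁ g₂ : EuclideanSpace ℝ (Fin d) → ℝ} {p ps b : P}
    {us : H1 ℝ Ω} {τs : L2Bdry ℝ Ω} (hτs : IsTrace us τs) (hg₁ : τs =ᵐ[surface Ω] g₁)
    (hus : ∀ (ψ : H1 ℝ Ω) (θ : L2Bdry ℝ Ω), IsTrace ψ θ →
      (∫ x in Ω, ((∑ i, h1grad us x i * h1grad ψ x i) + h1val us x * h1val ψ x))
        = (∫ x in Ω₀, ι ps x * h1val ψ x) + ∫ x, g₂ x * θ x ∂(surface Ω))
    {u w : H1 ℂ Ω} (hu : IsState Ω Ω₀ g₁ g₂ (ι p) u) (hw : IsAdjointState u w)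
    (h : ∀ q : P, ⟪b, q⟫ + ∫ x in Ω₀, (h1val w x).im * ι q x = 0) :
    ∃ δ₁ δ₂ w₁ w₂ : TraceSpace Ω,
      CoupledState (traceFst Ω) (traceSnd Ω) ((sourceL hsub ι).comp (traceVal Ω)) (p - ps) δ₁ δ₂ ∧
      CoupledState (traceFst Ω) (traceSnd Ω) (traceVal Ω) (traceVal Ω δ₂) w₁ w₂ ∧
      b + (sourceL hsub ι).comp (traceVal Ω) w₂ = 0 := by
  obtain ⟨τ, hτ, hu⟩ := hu
  obtain ⟨σ, hσ, hw⟩ := hw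
  exact ⟨_, _, _, _, coupledState_of_isState hsub (inner_sourceL_comp hsub ι) hτ hu hτs hg₁ hus,
    coupledState_of_isAdjointState hσ hw, add_sourceL_eq_zero hsub ι h⟩

/-- Weak convergence of the second order flow to an exact source, for any Hilbert space of sources
which is continuously mapped to `L²(Ω₀)`. -/
theorem exists_weaklyTendsto_of_isSOARSolution (hΩ : IsOpen Ω) (hsub : Ω₀ ⊆ Ω)
    (ι : P →L[ℝ] L2 ℝ Ω₀) {g₁ g₂ : EuclideanSpace ℝ (Fin d) → ℝ} {η : ℝ} (hη : 0 < η)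
    (hex : ∃ p, IsExactSource Ω Ω₀ g₁ g₂ (ι p)) {p₀ v₀ : P} {p : ℝ → P}
    (hp : IsSOARSolution Ω Ω₀ ι g₁ g₂ η p₀ v₀ p) :
    ∃ l, IsExactSource Ω Ω₀ g₁ g₂ (ι l) ∧ WeaklyTendsto p l := by
  obtain ⟨ps, us, τs, hτs, hg₁, hus⟩ := hex
  obtain ⟨v, a, hpv, -, hva, -, -, hode⟩ := hp
  obtain ⟨l, ⟨D, hD⟩, hl⟩ := exists_weak_limit_of_soar (B := traceFst Ω) (K := traceSnd Ω)
    (κ := (sourceL hsub ι).comp (traceVal Ω)) (J := traceVal Ω) splitsNorm_traceSpace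
    (fun x hx => traceFst_eq_zero hΩ hx) (fun x hx => sourceL_comp_eq_zero hsub ι hx)
    hη (ps := ps) (p := p)
    (fun t ht => (hpv t ht.le).hasDerivAt (Ici_mem_nhds ht)) hva (fun t ht => by
      obtain ⟨u, w, hu, hw, heq⟩ := hode t ht
      exact exists_coupledState hsub ι hτs hg₁ hus hu hw heq)
  -- The state of the limit source is the reference state plus `D`: it keeps the trace `g₁` and the
  -- Neumann data `g₂`.
  have hsum := hD.map_add_of_sub (y := hτs.pair)
    (r := fun ψ => ∫ x in Ω₀, ι l x * h1val (traceFst Ω ψ) x)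
    (r' := fun ψ => ∫ x in Ω₀, ι ps x * h1val (traceFst Ω ψ) x)
    (g := fun ψ => ∫ x, g₂ x * traceSnd Ω ψ x ∂(surface Ω)) 
    (inner_sourceL_comp hsub ι l) (inner_sourceL_comp hsub ι ps)
    (fun ψ => (h1_inner _ _).trans (hus _ _ (isTrace_traceFst_traceSnd ψ)))
  refine ⟨l, ⟨traceFst Ω (hτs.pair + D), traceSnd Ω (hτs.pair + D),
    isTrace_traceFst_traceSnd _, ?_, fun ψ θ hψ => ?_⟩, weaklyTendsto_of_inner hl⟩
  · rw [hsum.1]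
    exact hg₁
  · exact (h1_inner _ _).symm.trans (hsum.2 hψ.pair)

end Reduction

end InverseSource

end

/-- Weak convergence of SOAR for exact data and constant damping `η ≥ 1`, for the source space
`P = L²(Ω₀)` (first part) and for the source space `P = H¹(Ω₀)` (second part). -/
theorem theorem3p4 {d : ℕ} (hd : d = 2 ∨ d = 3)
    (Ω Ω₀ : Set (EuclideanSpace ℝ (Fin d)))
    (hΩ : InverseSource.IsSmoothBoundedDomain Ω) (hΩ₀ : IsOpen Ω₀) (hsub : Ω₀ ⊆ Ω)
    (g₁ g₂ : EuclideanSpace ℝ (Fin d) → ℝ)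
    (hg₁ : MemLp g₁ ∞ (InverseSource.surface Ω)) (hg₂ : MemLp g₂ ∞ (InverseSource.surface Ω))
    (η : ℝ) (hη : 1 ≤ η) :
    ((∃ p : InverseSource.L2 ℝ Ω₀, InverseSource.IsExactSource Ω Ω₀ g₁ g₂ p) →
      ∀ (p₀ v₀ : InverseSource.L2 ℝ Ω₀) (p : ℝ → InverseSource.L2 ℝ Ω₀),
        InverseSource.IsSOARSolution Ω Ω₀ id g₁ g₂ η p₀ v₀ p →
        ∃ l : InverseSource.L2 ℝ Ω₀, InverseSource.IsExactSource Ω Ω₀ g₁ g₂ l ∧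
          InverseSource.WeaklyTendsto p l) ∧
    ((∃ p : InverseSource.H1 ℝ Ω₀, InverseSource.IsExactSource Ω Ω₀ g₁ g₂ (InverseSource.h1val p)) →
      ∀ (p₀ v₀ : InverseSource.H1 ℝ Ω₀) (p : ℝ → InverseSource.H1 ℝ Ω₀),
        InverseSource.IsSOARSolution Ω Ω₀ InverseSource.h1val g₁ g₂ η p₀ v₀ p →
        ∃ l : InverseSource.H1 ℝ Ω₀, InverseSource.IsExactSource Ω Ω₀ g₁ g₂ (InverseSource.h1val l) ∧
          InverseSource.WeaklyTendsto p l) := by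
  have hη' : 0 < η := zero_lt_one.trans_le hη
  exact ⟨fun hex p₀ v₀ p hp =>
      InverseSource.exists_weaklyTendsto_of_isSOARSolution hΩ.isOpen hsub
        (ContinuousLinearMap.id ℝ (InverseSource.L2 ℝ Ω₀)) hη' hex hp,
    fun hex p₀ v₀ p hp =>
      InverseSource.exists_weaklyTendsto_of_isSOARSolution hΩ.isOpen hsub
        (InverseSource.h1valL Ω₀) hη' hex hp⟩
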